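/- Let $n\ge 1$ and let $\Omega\subset\mathbb{C}^n$ be a bounded domain. Put $d^c=\frac{\sqrt{-1}}{2\pi}(\bar\partial-\partial)$, so that $dd^c=\frac{\sqrt{-1}}{\pi}\partial\bar\partial$, and $\omega=dd^c|z|^2$. For $f\in W^{1,2}(\Omega,\mathbb{R})$ let $\Gamma_f$ be the set of all positive closed $(1,1)$-currents $T$ on $\Omega$ with $df\wedge d^cf\le T$ weakly in $\Omega$, and for a positive $(1,1)$-current $T$ let $\|T\|_\Omega=\int_\Omega T\wedge\omega^{n-1}\in[0,\infty]$. Define $$W^*(\Omega)=\{f\in W^{1,2}(\Omega,\mathbb{R}):\ \text{there exists } T\in\Gamma_f \text{ with } \|T\|_\Omega<\infty\},\qquad W^*_0(\Omega)=W^*(\Omega)\cap W^{1,2}_0(\Omega),$$ $$\|f\|_*^2=\|f\|_{L^2(\Omega)}^2+\inf_{T\in\Gamma_f}\|T\|_\Omega \qquad (f\in W^*(\Omega)),$$ where $W^{1,2}_0(\Omega)$ is the closure of $C_c^\infty(\Omega)$ in $W^{1,2}(\Omega,\mathbb{R})$ and $L^2$ refers to Lebesgue measure. Then the following hold. (a)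 $W^*(\Omega)$ is a real vector space, $\|\cdot\|_*$ is a norm on it, and this norm dominates the $W^{1,2}$ norm: for every $f\in W^*(\Omega)$, $$\|f\|_{L^2(\Omega)}^2+\int_\Omega df\wedge d^cf\wedge\omega^{n-1}\ =\ \|f\|_{L^2(\Omega)}^2+\frac{c_n}{4}\int_\Omega|\nabla f|^2\,dx\ \le\ \|f\|_*^2,\qquad c_n=(n-1)!\,\Big(\frac{2}{\pi}\Big)^n,$$ where $\nabla f$ is the gradient of $f$ in $\mathbb{R}^{2n}$. Consequently, $\big(\|f\|_{L^2(\Omega)}^2+\int_\Omega|\nabla f|^2dx\big)^{1/2}\le \max\{1,\sqrt{4/c_n}\}\,\|f\|_*$. (b) $W^*(\Omega)$ and $W^*_0(\Omega)$, which is a linear subspace of $W^*(\Omega)$, are Banach spaces with the norm $\|\cdot\|_*$. -/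

import Mathlib

open MeasureTheory TopologicalSpace
open scoped ENNReal Distributions LineDeriv ComplexOrder

noncomputable section

namespace ComplexSobolev

/-- The space `ℂⁿ` with its Euclidean norm. -/
abbrev Cn (n : ℕ) := EuclideanSpace ℂ (Fin n)

variable {n : ℕ}

/-- The unit vector `e_j`, i.e. the direction `x_j`, where `z_j = x_j + i y_j`. -/
def dirX (j : Fin n) : Cn n := EuclideanSpace.single j 1

/-- The vector `i e_j`, i.e. the direction `y_j`, where `z_j = x_j + i y_j`. -/
def dirY (j : Fin n) : Cn n := EuclideanSpace.single j Complex.I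

/-! ### The Sobolev space `W^{1,2}(Ω, ℝ)` -/

/-- The real space `L²(Ω, ℝ)` for Lebesgue measure on `Ω`. -/
abbrev L2 (Ω : Opens (Cn n)) := Lp ℝ 2 ((volume : Measure (Cn n)).restrict (Ω : Set (Cn n)))

/-- `g` is the weak derivative of `f` in the real direction `v` on `Ω`. -/
def HasWeakDeriv {Ω : Opens (Cn n)} (f g : L2 Ω) (v : Cn n) : Prop :=
  ∀ φ : 𝓓(Ω, ℝ),
    ∫ x in (Ω : Set (Cn n)), f x * (∂_{v} φ) x = - ∫ x in (Ω : Set (Cn n)), g x * φ x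

/-- `W^{1,2}(Ω, ℝ)`: the functions of `L²(Ω, ℝ)` all of whose first order weak derivatives
are in `L²(Ω, ℝ)`. -/
def W12 (Ω : Opens (Cn n)) : Set (L2 Ω) :=
  {f | ∀ v : Cn n, ∃ g : L2 Ω, HasWeakDeriv f g v}

open Classical in
/-- The weak derivative of `f` in the real direction `v` (it is unique when it exists; the value
is `0` if there is none). -/
def weakDeriv {Ω : Opens (Cn n)} (f : L2 Ω) (v : Cn n) : L2 Ω :=
  if h : ∃ g : L2 Ω, HasWeakDeriv f g v then h.choose else 0

/-- `∫_Ω |∇f|² dx`, where `∇f` is the gradient of `f` in `ℝ^{2n}`. -/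
def gradSq {Ω : Opens (Cn n)} (f : L2 Ω) : ℝ :=
  ∑ j : Fin n, (‖weakDeriv f (dirX j)‖ ^ 2 + ‖weakDeriv f (dirY j)‖ ^ 2)

/-- The `W^{1,2}` norm `(‖f‖²_{L²} + ∫_Ω |∇f|² dx)^{1/2}`. -/
def sobolevNorm {Ω : Opens (Cn n)} (f : L2 Ω) : ℝ :=
  √(‖f‖ ^ 2 + gradSq f)

/-- `W^{1,2}_0(Ω)`: the closure of `C_c^∞(Ω)` in `W^{1,2}(Ω, ℝ)`. -/
def W12Zero (Ω : Opens (Cn n)) : Set (L2 Ω) :=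
  {f | f ∈ W12 Ω ∧ ∀ ε > 0, ∃ φ : 𝓓(Ω, ℝ), ∃ g ∈ W12 Ω,
    (∀ᵐ x ∂((volume : Measure (Cn n)).restrict (Ω : Set (Cn n))), g x = φ x) ∧
      sobolevNorm (f - g) < ε}

/-- `∂f/∂z_j = (∂f/∂x_j - i ∂f/∂y_j) / 2`, in the weak sense. As `f` is real valued,
`∂f/∂z̄_j` is its complex conjugate. -/
def wirtinger {Ω : Opens (Cn n)} (f : L2 Ω) (j : Fin n) (x : Cn n) : ℂ :=
  (1 / 2 : ℂ) * ((weakDeriv f (dirX j) x : ℂ) - Complex.I * (weakDeriv f (dirY j) x : ℂ))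

/-! ### Currents of bidegree `(1,1)`

Normalization: `d^c = (i/2π)(∂̄ - ∂)`, so that `dd^c = (i/π) ∂∂̄`, and
`ω = dd^c|z|² = ∑_j (i/π) dz_j ∧ dz̄_j`. -/

/-- A current of bidegree `(1,1)` on `Ω`, as a differential form with distribution coefficients:
the family `T` is the current `∑_{j,k} T j k (i/π) dz_j ∧ dz̄_k`, with `T j k` a complex
distribution on `Ω`. -/
abbrev Current11 (Ω : Opens (Cn n)) := Fin n → Fin n → (𝓓(Ω, ℂ) →L[ℂ] ℂ)

/-- A test form of bidegree `(n-1,n-1)` on `Ω`. The form `Φ` is given by its coefficients in the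
basis dual to the forms `(i/π) dz_j ∧ dz̄_k` under the wedge product, that is, by the functions
`Φ j k` with `(i/π) dz_j ∧ dz̄_k ∧ Φ = Φ j k · dV`, with `dV` the Lebesgue volume form. -/
abbrev TestForm (Ω : Opens (Cn n)) := Fin n → Fin n → 𝓓(Ω, ℂ)

/-- The value `⟨T, Φ⟩ = ∫_Ω T ∧ Φ` of a `(1,1)`-current on a test form. -/
def Current11.pair {Ω : Opens (Cn n)} (T : Current11 Ω) (Φ : TestForm Ω) : ℂ :=
  ∑ j : Fin n, ∑ k : Fin n, T j k (Φ j k)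

/-- `Φ` is (strongly) positive at each point. The strongly positive covectors of bidegree
`(n-1,n-1)` are the nonnegative combinations of the
`i α_1 ∧ ᾱ_1 ∧ ⋯ ∧ i α_{n-1} ∧ ᾱ_{n-1}` with `α_1, …, α_{n-1}` of type `(1,0)`;
the coefficients of these are the matrices `(ζ_j ζ̄_k)` with `ζ` in `ℂⁿ`
(`ζ` spans the common kernel of the `α_l`, or vanishes), whose nonnegative combinations
are the positive semidefinite Hermitian matrices. -/
def TestForm.IsStronglyPositive {Ω : Opens (Cn n)} (Φ : TestForm Ω) : Prop :=
  ∀ x : Cn n, (Matrix.of fun j k : Fin n => Φ j k x).PosSemidef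

/-- A `(1,1)`-current is positive if it is nonnegative on all strongly positive test forms. -/
def Current11.IsPositive {Ω : Opens (Cn n)} (T : Current11 Ω) : Prop :=
  ∀ Φ : TestForm Ω, Φ.IsStronglyPositive → 0 ≤ T.pair Φ

/-- `∂φ/∂z_l` for a test function `φ`. -/
def testDz {Ω : Opens (Cn n)} (l : Fin n) (φ : 𝓓(Ω, ℂ)) : 𝓓(Ω, ℂ) :=
  (1 / 2 : ℂ) • (∂_{dirX l} φ - Complex.I • ∂_{dirY l} φ)

/-- `∂φ/∂z̄_l` for a test function `φ`. -/
def testDzBar {Ω : Opens (Cn n)} (l : Fin n) (φ : 𝓓(Ω, ℂ)) : 𝓓(Ω, ℂ) :=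
  (1 / 2 : ℂ) • (∂_{dirX l} φ + Complex.I • ∂_{dirY l} φ)

/-- `dT = 0`. The coefficients of `∂T` and `∂̄T` are, up to sign and constants,
`∂T_{jk}/∂z_l - ∂T_{lk}/∂z_j` and `∂T_{jk}/∂z̄_l - ∂T_{jl}/∂z̄_k`, where
`(∂S/∂z_l)(φ) = -S(∂φ/∂z_l)` for a distribution `S`. -/
def Current11.IsClosed {Ω : Opens (Cn n)} (T : Current11 Ω) : Prop :=
  ∀ (j k l : Fin n) (φ : 𝓓(Ω, ℂ)),
    T j k (testDz l φ) = T l k (testDz j φ) ∧ T j k (testDzBar l φ) = T j l (testDzBar k φ)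

/-- The constant `(n-1)! (2/π)ⁿ`: since `(i/π) dz_m ∧ dz̄_m = (2/π) dx_m ∧ dy_m` one has
`(i/π) dz_j ∧ dz̄_k ∧ ω^{n-1} = δ_{jk} (n-1)! (2/π)ⁿ dV`. -/
def omegaConst (n : ℕ) : ℝ := (n - 1).factorial * (2 / Real.pi) ^ n

/-- The test form `χ ω^{n-1}`, for a test function `χ`. -/
def omegaForm {Ω : Opens (Cn n)} (χ : 𝓓(Ω, ℂ)) : TestForm Ω :=
  fun j k => if j = k then (omegaConst n : ℂ) • χ else 0

/-- The total mass `‖T‖_Ω = ∫_Ω T ∧ ω^{n-1}` of a positive `(1,1)`-current: the total mass of the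
positive measure `T ∧ ω^{n-1}`, i.e. the supremum of `∫ χ T ∧ ω^{n-1}` over the test functions
`0 ≤ χ ≤ 1`. -/
def Current11.mass {Ω : Opens (Cn n)} (T : Current11 Ω) : ℝ≥0∞ :=
  ⨆ (χ : 𝓓(Ω, ℂ)) (_ : ∀ x, 0 ≤ χ x ∧ χ x ≤ 1), ENNReal.ofReal (T.pair (omegaForm χ)).re

/-- The current `df ∧ d^c f = ∑_{j,k} (∂f/∂z_j) (∂f/∂z̄_k) (i/π) dz_j ∧ dz̄_k`
for `f` in `W^{1,2}(Ω, ℝ)`; its coefficients are integrable functions. -/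
def dfdcf {Ω : Opens (Cn n)} (f : L2 Ω) : Current11 Ω := fun j k =>
  TestFunction.integralAgainstBilinCLM (ContinuousLinearMap.mul ℂ ℂ)
    ((volume : Measure (Cn n)).restrict (Ω : Set (Cn n)))
    (fun x => wirtinger f j x * (starRingEnd ℂ) (wirtinger f k x))

/-! ### The complex Sobolev space -/

/-- `Γ_f`: the positive closed `(1,1)`-currents `T` with `df ∧ d^c f ≤ T` weakly in `Ω`. -/
def Gam {Ω : Opens (Cn n)} (f : L2 Ω) : Set (Current11 Ω) :=
  {T | T.IsPositive ∧ T.IsClosed ∧ Current11.IsPositive (T - dfdcf f)}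

/-- `W^*(Ω)`. -/
def WStar (Ω : Opens (Cn n)) : Set (L2 Ω) :=
  {f | f ∈ W12 Ω ∧ ∃ T ∈ Gam f, T.mass < ⊤}

/-- `W^*_0(Ω) = W^*(Ω) ∩ W^{1,2}_0(Ω)`. -/
def WStarZero (Ω : Opens (Cn n)) : Set (L2 Ω) := WStar Ω ∩ W12Zero Ω

/-- `‖f‖_* = (‖f‖²_{L²} + inf_{T ∈ Γ_f} ‖T‖_Ω)^{1/2}`. -/
def starNorm {Ω : Opens (Cn n)} (f : L2 Ω) : ℝ :=
  √(‖f‖ ^ 2 + (⨅ T ∈ Gam f, T.mass).toReal)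

/-! ### Norms on a subspace -/

/-- The function `N` restricts to a norm on the real vector space `V`. -/
structure IsNormOn {X : Type*} [AddCommGroup X] [Module ℝ X] (V : Submodule ℝ X) (N : X → ℝ) :
    Prop where
  nonneg : ∀ f ∈ V, 0 ≤ N f
  eq_zero : ∀ f ∈ V, N f = 0 → f = 0
  smul : ∀ (c : ℝ), ∀ f ∈ V, N (c • f) = |c| * N f
  add_le : ∀ f ∈ V, ∀ g ∈ V, N (f + g) ≤ N f + N g

/-- `V` is a Banach space with the norm `N`: every Cauchy sequence converges. -/
structure IsBanachWith {X : Type*} [AddCommGroup X] [Module ℝ X] (V : Submodule ℝ X)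
    (N : X → ℝ) : Prop where
  isNormOn : IsNormOn V N
  complete : ∀ u : ℕ → X, (∀ k, u k ∈ V) →
    (∀ ε > 0, ∃ m, ∀ j ≥ m, ∀ k ≥ m, N (u j - u k) < ε) →
    ∃ f ∈ V, ∀ ε > 0, ∃ m, ∀ k ≥ m, N (u k - f) < ε

end ComplexSobolev

end

noncomputable section

namespace ComplexSobolev

variable {n : ℕ} {Ω : Opens (Cn n)}

/-! ### Weak derivatives -/

/-! The current `df ∧ d^c f` is a positive quadratic expression in `f`. Hence, for real `s, t > 0`,
`d(f+g) ∧ d^c(f+g)` is at most `(s+t)/s` times `df ∧ d^c f` plus `(s+t)/t` times `dg ∧ d^c g`: the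
difference is `(st)⁻¹` times the current of `t f - s g` (`pair_dfdcf_add_le`). The same combination
of `T ∈ Γ_f` and `S ∈ Γ_g` therefore lies in `Γ_{f+g}`. With `s` and `t` close to the square roots
of the two least masses, its mass is close to the square of their sum, so the square root of the
least mass is subadditive (`sqrt_starMass_add_le`). The triangle inequality for `‖·‖_*` follows by
Minkowski's inequality in the plane. Testing `df ∧ d^c f ≤ T` against cutoffs times `ω^{n-1}` bounds
the Dirichlet energy by the mass (`mass_ge_of_sub_isPositive`).

For completeness it suffices to sum series `∑ u_i` with `∑ ‖u_i‖_* < ∞`. Such a series converges in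
`W^{1,2}` to some `f`. Choose `T_i ∈ Γ_{u_i}` with mass at most `a_i²` and `A = ∑ a_i < ∞`.
Iterating the weighted inequality shows that `∑ (2A/a_i) T_i` belongs to `Γ_f` and has mass at most
`2A²` (`exists_mem_Gam_of_series`). This sum is a current because the coefficients of a positive
current are controlled by its mass (`Current11.IsPositive.norm_apply_le`). Positivity and closedness
pass to the sum termwise, so no weak compactness is needed. Applied to the tails, the same bound
gives convergence in `‖·‖_*`.

Finally, `W^{1,2}_0` is closed for the `W^{1,2}` norm, which `‖·‖_*` dominates, so `W^*_0` is a
closed subspace of `W^*`. -/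

lemma memLp_testFunction (φ : 𝓓(Ω, ℝ)) :
    MemLp φ 2 ((volume : Measure (Cn n)).restrict (Ω : Set (Cn n))) :=
  (φ.continuous.memLp_of_hasCompactSupport φ.hasCompactSupport).restrict _

/-- The class in `L²(Ω, ℝ)` of a test function. -/
def testL2 (φ : 𝓓(Ω, ℝ)) : L2 Ω := (memLp_testFunction φ).toLp φ

lemma coeFn_testL2 (φ : 𝓓(Ω, ℝ)) :
    testL2 φ =ᵐ[(volume : Measure (Cn n)).restrict (Ω : Set (Cn n))] φ :=
  MemLp.coeFn_toLp _

lemma testL2_add (φ ψ : 𝓓(Ω, ℝ)) : testL2 (φ + ψ) = testL2 φ + testL2 ψ :=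
  MemLp.toLp_add (memLp_testFunction φ) (memLp_testFunction ψ)

lemma testL2_smul (c : ℝ) (φ : 𝓓(Ω, ℝ)) : testL2 (c • φ) = c • testL2 φ :=
  MemLp.toLp_const_smul c (memLp_testFunction φ)

lemma integral_mul_testFunction (f : L2 Ω) (φ : 𝓓(Ω, ℝ)) :
    ∫ x in (Ω : Set (Cn n)), f x * φ x = inner ℝ f (testL2 φ) := by
  rw [L2.inner_def]
  refine integral_congr_ae ?_
  filter_upwards [coeFn_testL2 φ] with x hx
  rw [hx]
  simp [mul_comm]

lemma hasWeakDeriv_iff {f g : L2 Ω} {v : Cn n} :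
    HasWeakDeriv f g v ↔
      ∀ φ : 𝓓(Ω, ℝ), inner ℝ f (testL2 (∂_{v} φ)) = - inner ℝ g (testL2 φ) := by
  simp only [HasWeakDeriv, integral_mul_testFunction]

/-- The fundamental lemma of the calculus of variations. It makes weak derivatives unique, so that
the chosen `weakDeriv` depends linearly on the function. -/
lemma eq_zero_of_inner_testL2 {g : L2 Ω} (h : ∀ φ : 𝓓(Ω, ℝ), inner ℝ g (testL2 φ) = 0) :
    g = 0 := by
  rw [Lp.eq_zero_iff_ae_eq_zero]
  have hloc : LocallyIntegrableOn g (Ω : Set (Cn n)) volume :=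
    locallyIntegrableOn_of_locallyIntegrable_restrict
      ((Lp.memLp g).locallyIntegrable (by norm_num))
  have := IsOpen.ae_eq_zero_of_integral_contDiff_smul_eq_zero Ω.isOpen hloc
    fun φ hφ hc hs => by
      have h1 := h ⟨φ, hφ, hc, hs⟩
      rw [← integral_mul_testFunction] at h1
      rw [← h1, ← setIntegral_eq_integral_of_forall_compl_eq_zero (s := (Ω : Set (Cn n)))]
      · exact integral_congr_ae (.of_forall fun x => mul_comm _ _)
      · intro x hx
        rw [image_eq_zero_of_notMem_tsupport (fun h' => hx (hs h')), zero_smul]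
  exact (ae_restrict_iff' Ω.isOpen.measurableSet).2 this

lemma HasWeakDeriv.unique {f g g' : L2 Ω} {v : Cn n} (h : HasWeakDeriv f g v)
    (h' : HasWeakDeriv f g' v) : g = g' := by
  rw [hasWeakDeriv_iff] at h h'
  rw [← sub_eq_zero]
  refine eq_zero_of_inner_testL2 fun φ => ?_
  rw [inner_sub_left]
  linarith [h φ, h' φ]

lemma HasWeakDeriv.weakDeriv_eq {f g : L2 Ω} {v : Cn n} (h : HasWeakDeriv f g v) :
    weakDeriv f v = g := by
  have h' : ∃ g : L2 Ω, HasWeakDeriv f g v := ⟨g, h⟩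
  rw [weakDeriv, dif_pos h']
  exact h'.choose_spec.unique h

lemma HasWeakDeriv.add {f g f' g' : L2 Ω} {v : Cn n} (h : HasWeakDeriv f g v)
    (h' : HasWeakDeriv f' g' v) : HasWeakDeriv (f + f') (g + g') v := by
  rw [hasWeakDeriv_iff] at *
  intro φ
  rw [inner_add_left, inner_add_left, h, h']
  ring

lemma HasWeakDeriv.smul {f g : L2 Ω} {v : Cn n} (c : ℝ) (h : HasWeakDeriv f g v) :
    HasWeakDeriv (c • f) (c • g) v := by
  rw [hasWeakDeriv_iff] at *
  intro φ
  rw [real_inner_smul_left, real_inner_smul_left, h]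
  ring

lemma hasWeakDeriv_zero (v : Cn n) : HasWeakDeriv (0 : L2 Ω) 0 v := by
  simp [hasWeakDeriv_iff]

lemma HasWeakDeriv.add_dir {f g g' : L2 Ω} {v w : Cn n} (h : HasWeakDeriv f g v)
    (h' : HasWeakDeriv f g' w) : HasWeakDeriv f (g + g') (v + w) := by
  rw [hasWeakDeriv_iff] at *
  intro φ
  rw [LineDeriv.lineDerivOp_left_add, testL2_add, inner_add_left, inner_add_right, h, h']
  ring

lemma HasWeakDeriv.smul_dir {f g : L2 Ω} {v : Cn n} (c : ℝ) (h : HasWeakDeriv f g v) :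
    HasWeakDeriv f (c • g) (c • v) := by
  rw [hasWeakDeriv_iff] at *
  intro φ
  rw [LineDeriv.lineDerivOp_left_smul, testL2_smul, real_inner_smul_left, real_inner_smul_right, h]
  ring

lemma HasWeakDeriv.zero_dir (f : L2 Ω) : HasWeakDeriv f 0 0 := by
  rw [hasWeakDeriv_iff]
  intro φ
  have : testL2 (0 : 𝓓(Ω, ℝ)) = 0 := by simpa using testL2_smul 0 (0 : 𝓓(Ω, ℝ))
  rw [LineDeriv.lineDerivOp_left_zero, this]
  simp

/-- For a fixed test function both sides of the defining identity are continuous in `L²`: weak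
differentiation is a closed operator. -/
lemma HasWeakDeriv.of_tendsto {f g : L2 Ω} {v : Cn n} {u w : ℕ → L2 Ω}
    (h : ∀ k, HasWeakDeriv (u k) (w k) v) (hu : Filter.Tendsto u .atTop (nhds f))
    (hw : Filter.Tendsto w .atTop (nhds g)) : HasWeakDeriv f g v := by
  simp only [hasWeakDeriv_iff] at *
  intro φ
  refine tendsto_nhds_unique (hu.inner tendsto_const_nhds) ?_
  simp only [h]
  exact (hw.inner tendsto_const_nhds).neg

/-- The coordinate directions of `ℂⁿ = ℝ²ⁿ`. -/
def coordDir : Fin n ⊕ Fin n → Cn n := Sum.elim dirX dirY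

lemma eq_sum_coordDir (v : Cn n) :
    v = ∑ j : Fin n, ((v j).re • dirX j + (v j).im • dirY j) := by
  ext k
  simp only [WithLp.ofLp_sum, Finset.sum_apply, PiLp.add_apply, PiLp.smul_apply, dirX, dirY,
    PiLp.single_apply]
  rw [Finset.sum_eq_single k]
  · simp [Complex.re_add_im]
  · intro b _ hb
    simp [hb.symm]
  · simp

/-- Weak derivatives are real linear in the direction, and the `2n` coordinate directions span `ℂⁿ`
over `ℝ`. -/
lemma mem_W12_of_coordDir {f : L2 Ω} (h : ∀ i, ∃ g : L2 Ω, HasWeakDeriv f g (coordDir i)) :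
    f ∈ W12 Ω := by
  intro v
  choose g hg using h
  refine ⟨∑ j : Fin n, ((v j).re • g (.inl j) + (v j).im • g (.inr j)), ?_⟩
  rw [eq_sum_coordDir v]
  have key : ∀ s : Finset (Fin n), HasWeakDeriv f
      (∑ j ∈ s, ((v j).re • g (.inl j) + (v j).im • g (.inr j)))
      (∑ j ∈ s, ((v j).re • dirX j + (v j).im • dirY j)) := by
    intro s
    induction s using Finset.induction_on with
    | empty => exact .zero_dir f
    | insert a s ha ih =>
      rw [Finset.sum_insert ha, Finset.sum_insert ha]
      exact (((hg (.inl a)).smul_dir _).add_dir ((hg (.inr a)).smul_dir _)).add_dir ih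
  convert key Finset.univ using 2
  rw [← eq_sum_coordDir v]

lemma hasWeakDeriv_weakDeriv {f : L2 Ω} (hf : f ∈ W12 Ω) (v : Cn n) :
    HasWeakDeriv f (weakDeriv f v) v := by
  obtain ⟨g, hg⟩ := hf v
  rwa [hg.weakDeriv_eq]

variable (Ω) in
/-- `W^{1,2}(Ω, ℝ)` as a subspace of `L²(Ω, ℝ)`. -/
def W12Sub : Submodule ℝ (L2 Ω) where
  carrier := W12 Ω
  add_mem' hf hg v := ⟨_, (hasWeakDeriv_weakDeriv hf v).add (hasWeakDeriv_weakDeriv hg v)⟩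
  zero_mem' v := ⟨0, hasWeakDeriv_zero v⟩
  smul_mem' c _ hf v := ⟨_, (hasWeakDeriv_weakDeriv hf v).smul c⟩

lemma weakDeriv_add {f g : L2 Ω} (hf : f ∈ W12 Ω) (hg : g ∈ W12 Ω) (v : Cn n) :
    weakDeriv (f + g) v = weakDeriv f v + weakDeriv g v :=
  ((hasWeakDeriv_weakDeriv hf v).add (hasWeakDeriv_weakDeriv hg v)).weakDeriv_eq

lemma weakDeriv_smul {f : L2 Ω} (c : ℝ) (hf : f ∈ W12 Ω) (v : Cn n) :
    weakDeriv (c • f) v = c • weakDeriv f v :=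
  ((hasWeakDeriv_weakDeriv hf v).smul c).weakDeriv_eq

/-- A function together with its weak partial derivatives. -/
def jet (f : L2 Ω) : PiLp 2 (fun _ : Option (Fin n ⊕ Fin n) => L2 Ω) :=
  WithLp.toLp 2 fun o => o.elim f fun i => weakDeriv f (coordDir i)

lemma gradSq_eq_sum (f : L2 Ω) : gradSq f = ∑ i, ‖weakDeriv f (coordDir i)‖ ^ 2 := by
  simp [gradSq, Fintype.sum_sum_type, coordDir, Finset.sum_add_distrib]

/-- Places `W^{1,2}` isometrically in a finite Hilbert sum of copies of `L²`, from which the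
triangle inequality and completeness are inherited. -/
lemma norm_jet (f : L2 Ω) : ‖jet f‖ = sobolevNorm f := by
  rw [PiLp.norm_eq_of_L2, sobolevNorm, Fintype.sum_option, gradSq_eq_sum]
  rfl

lemma jet_add {f g : L2 Ω} (hf : f ∈ W12 Ω) (hg : g ∈ W12 Ω) : jet (f + g) = jet f + jet g := by
  ext1 o
  cases o with
  | none => rfl
  | some i => exact weakDeriv_add hf hg _

lemma jet_smul {f : L2 Ω} (c : ℝ) (hf : f ∈ W12 Ω) : jet (c • f) = c • jet f := by
  ext1 o
  cases o with
  | none => rfl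
  | some i => exact weakDeriv_smul c hf _

lemma gradSq_nonneg (f : L2 Ω) : 0 ≤ gradSq f := by
  unfold gradSq
  positivity

lemma sobolevNorm_nonneg (f : L2 Ω) : 0 ≤ sobolevNorm f := Real.sqrt_nonneg _

lemma sobolevNorm_add_le {f g : L2 Ω} (hf : f ∈ W12 Ω) (hg : g ∈ W12 Ω) :
    sobolevNorm (f + g) ≤ sobolevNorm f + sobolevNorm g := by
  simp only [← norm_jet, jet_add hf hg]
  exact norm_add_le _ _

lemma sobolevNorm_smul {f : L2 Ω} (c : ℝ) (hf : f ∈ W12 Ω) :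
    sobolevNorm (c • f) = |c| * sobolevNorm f := by
  simp only [← norm_jet, jet_smul c hf, norm_smul, Real.norm_eq_abs]

/-- `W^{1,2}(Ω, ℝ)` is complete, in terms of series. -/
lemma exists_tendsto_sobolevNorm {u : ℕ → L2 Ω} (hu : ∀ k, u k ∈ W12 Ω)
    (hs : Summable fun k => sobolevNorm (u k)) :
    ∃ f ∈ W12 Ω, Filter.Tendsto (fun k => sobolevNorm (f - ∑ i ∈ Finset.range k, u i))
      .atTop (nhds 0) := by
  have hmem : ∀ k, ∑ i ∈ Finset.range k, u i ∈ W12 Ω := fun k =>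
    (W12Sub Ω).sum_mem fun i _ => hu i
  have hjet : ∀ k, jet (∑ i ∈ Finset.range k, u i) = ∑ i ∈ Finset.range k, jet (u i) := by
    intro k
    induction k with
    | zero => simpa using jet_smul 0 (W12Sub Ω).zero_mem
    | succ k ih => rw [Finset.sum_range_succ, Finset.sum_range_succ, jet_add (hmem k) (hu k), ih]
  have hs' : Summable fun k => jet (u k) := by
    refine Summable.of_norm ?_
    simpa only [norm_jet] using hs
  obtain ⟨F, hF⟩ := hs'
  have hF := hF.tendsto_sum_nat
  simp only [← hjet] at hF
  have hcoord : ∀ o, Filter.Tendsto (fun k => jet (∑ i ∈ Finset.range k, u i) o) .atTop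
      (nhds (F o)) := fun o => ((PiLp.continuous_apply 2 _ o).tendsto F).comp hF
  -- Closedness of weak differentiation: the remaining components of the limit jet are the
  -- derivatives of its component `none`.
  have hd : ∀ i, HasWeakDeriv (F none) (F (some i)) (coordDir i) := fun i =>
    .of_tendsto (fun k => hasWeakDeriv_weakDeriv (hmem k) (coordDir i))
      (hcoord none) (hcoord (some i))
  have hmemF : F none ∈ W12 Ω := mem_W12_of_coordDir fun i => ⟨_, hd i⟩
  have hjF : jet (F none) = F := by
    ext1 o
    cases o with
    | none => rfl
    | some i => exact (hd i).weakDeriv_eq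
  refine ⟨F none, hmemF, ?_⟩
  have : ∀ k, sobolevNorm (F none - ∑ i ∈ Finset.range k, u i)
      = ‖F - jet (∑ i ∈ Finset.range k, u i)‖ := by
    intro k
    have h1 := jet_smul (-1) (hmem k)
    rw [← norm_jet, sub_eq_add_neg, ← neg_one_smul ℝ (∑ i ∈ Finset.range k, u i),
      jet_add hmemF ((W12Sub Ω).smul_mem _ (hmem k)), h1, hjF, neg_one_smul, sub_eq_add_neg]
  simp only [this]
  simpa using (tendsto_const_nhds (x := F)).sub hF |>.norm

variable (Ω) in
/-- `W^{1,2}_0(Ω)` as a subspace of `L²(Ω, ℝ)`. -/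
def W12ZeroSub : Submodule ℝ (L2 Ω) where
  carrier := W12Zero Ω
  zero_mem' := ⟨(W12Sub Ω).zero_mem, fun ε hε => ⟨0, 0, (W12Sub Ω).zero_mem,
    by filter_upwards [Lp.coeFn_zero ℝ 2 ((volume : Measure (Cn n)).restrict (Ω : Set (Cn n)))]
        with x hx using by simpa using hx,
    by simpa using (sobolevNorm_smul 0 (W12Sub Ω).zero_mem).trans_lt (by simpa using hε)⟩⟩
  add_mem' := by
    rintro f f' ⟨hf, h⟩ ⟨hf', h'⟩
    refine ⟨(W12Sub Ω).add_mem hf hf', fun ε hε => ?_⟩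
    obtain ⟨φ, g, hg, hφ, hn⟩ := h (ε / 2) (half_pos hε)
    obtain ⟨φ', g', hg', hφ', hn'⟩ := h' (ε / 2) (half_pos hε)
    refine ⟨φ + φ', g + g', (W12Sub Ω).add_mem hg hg', ?_, ?_⟩
    · filter_upwards [Lp.coeFn_add g g', hφ, hφ'] with x hx h1 h2
      rw [FunLike.coe_add, Pi.add_apply, ← h1, ← h2, ← Pi.add_apply]
      exact hx
    · rw [add_sub_add_comm]
      have := sobolevNorm_add_le ((W12Sub Ω).sub_mem hf hg) ((W12Sub Ω).sub_mem hf' hg')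
      linarith
  smul_mem' := by
    rintro c f ⟨hf, h⟩
    refine ⟨(W12Sub Ω).smul_mem c hf, fun ε hε => ?_⟩
    -- The `+ 1` covers `c = 0`.
    obtain ⟨φ, g, hg, hφ, hn⟩ := h (ε / (|c| + 1)) (by positivity)
    refine ⟨c • φ, c • g, (W12Sub Ω).smul_mem c hg, ?_, ?_⟩
    · filter_upwards [Lp.coeFn_smul c g, hφ] with x hx h1
      rw [FunLike.coe_smul, Pi.smul_apply, ← h1, ← Pi.smul_apply]
      exact hx
    · rw [← smul_sub, sobolevNorm_smul c ((W12Sub Ω).sub_mem hf hg)]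
      rw [lt_div_iff₀ (by positivity)] at hn
      nlinarith [sobolevNorm_nonneg (f - g)]

/-- `W^{1,2}_0(Ω)` is closed in `W^{1,2}(Ω, ℝ)`. -/
lemma mem_W12Zero_of_approx {f : L2 Ω} (hf : f ∈ W12 Ω)
    (h : ∀ ε > 0, ∃ g ∈ W12Zero Ω, sobolevNorm (f - g) < ε) : f ∈ W12Zero Ω := by
  refine ⟨hf, fun ε hε => ?_⟩
  obtain ⟨g, hg, hfg⟩ := h (ε / 2) (half_pos hε)
  obtain ⟨φ, g', hg', hφ, hn⟩ := hg.2 (ε / 2) (half_pos hε)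
  refine ⟨φ, g', hg', hφ, ?_⟩
  have := sobolevNorm_add_le ((W12Sub Ω).sub_mem hf hg.1) ((W12Sub Ω).sub_mem hg.1 hg')
  rw [sub_add_sub_cancel] at this
  linarith

/-! ### Completeness in terms of absolutely convergent series -/

section Norms

variable {X : Type*} [AddCommGroup X] [Module ℝ X]

lemma IsNormOn.map_neg {V : Submodule ℝ X} {N : X → ℝ} (h : IsNormOn V N) {f : X} (hf : f ∈ V) :
    N (-f) = N f := by
  simpa using h.smul (-1) f hf

lemma IsNormOn.mono {V W : Submodule ℝ X} {N : X → ℝ} (h : IsNormOn V N) (hW : W ≤ V) :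
    IsNormOn W N where
  nonneg f hf := h.nonneg f (hW hf)
  eq_zero f hf := h.eq_zero f (hW hf)
  smul c f hf := h.smul c f (hW hf)
  add_le f hf g hg := h.add_le f (hW hf) g (hW hg)

/-- The usual criterion that a normed group is complete once its absolutely convergent series
converge, applied to `V` with the metric defined by `N`. -/
lemma IsNormOn.isBanachWith {V : Submodule ℝ X} {N : X → ℝ} (h : IsNormOn V N)
    (hser : ∀ u : ℕ → X, (∀ k, u k ∈ V) → (Summable fun k => N (u k)) →
      ∃ f ∈ V, Filter.Tendsto (fun k => N (f - ∑ i ∈ Finset.range k, u i)) .atTop (nhds 0)) :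
    IsBanachWith V N where
  isNormOn := h
  complete u hu hc := by
    let G : AddGroupNorm V :=
      { toFun := fun f => N f
        map_zero' := by simpa using h.smul 0 0 V.zero_mem
        add_le' := fun f g => h.add_le f f.2 g g.2
        neg' := fun f => by simpa using h.map_neg f.2
        eq_zero_of_map_eq_zero' := fun f hf => Subtype.ext (h.eq_zero f f.2 hf) }
    let _ : NormedAddCommGroup V := G.toNormedAddCommGroup
    have hnorm : ∀ f : V, ‖f‖ = N f := fun _ => rfl
    have : CompleteSpace V := by
      refine NormedAddCommGroup.completeSpace_of_summable_imp_tendsto fun w hw => ?_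
      obtain ⟨f, hf, hlim⟩ := hser (fun k => w k) (fun k => (w k).2) hw
      refine ⟨⟨f, hf⟩, ?_⟩
      rw [tendsto_iff_norm_sub_tendsto_zero]
      refine hlim.congr fun k => ?_
      rw [norm_sub_rev, hnorm]
      simp
    have hcau : CauchySeq fun k => (⟨u k, hu k⟩ : V) := by
      rw [Metric.cauchySeq_iff]
      intro ε hε
      obtain ⟨m, hm⟩ := hc ε hε
      refine ⟨m, fun j hj k hk => ?_⟩
      rw [dist_eq_norm]
      exact hm j hj k hk
    obtain ⟨f, hf⟩ := cauchySeq_tendsto_of_complete hcau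
    refine ⟨f, f.2, fun ε hε => ?_⟩
    obtain ⟨m, hm⟩ := Metric.tendsto_atTop.1 hf ε hε
    refine ⟨m, fun k hk => ?_⟩
    have := hm k hk
    rwa [dist_eq_norm] at this

lemma IsBanachWith.of_le {V W : Submodule ℝ X} {N : X → ℝ} (h : IsBanachWith V N) (hW : W ≤ V)
    (hclosed : ∀ f ∈ V, (∀ ε > 0, ∃ g ∈ W, N (f - g) < ε) → f ∈ W) : IsBanachWith W N where
  isNormOn := h.isNormOn.mono hW
  complete u hu hc := by
    obtain ⟨f, hf, hlim⟩ := h.complete u (fun k => hW (hu k)) hc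
    refine ⟨f, hclosed f hf fun ε hε => ?_, hlim⟩
    obtain ⟨m, hm⟩ := hlim ε hε
    refine ⟨u m, hu m, ?_⟩
    rw [← neg_sub, h.isNormOn.map_neg (V.sub_mem (hW (hu m)) hf)]
    exact hm m le_rfl

end Norms

/-! ### Positive currents -/

lemma exists_cutoff {K : Set (Cn n)} (hK : IsCompact K) (hKΩ : K ⊆ Ω) :
    ∃ χ : 𝓓(Ω, ℂ), (∀ x, 0 ≤ χ x ∧ χ x ≤ 1) ∧ ∀ x ∈ K, χ x = 1 := by
  obtain ⟨L, hL, hKL, hLΩ⟩ := exists_compact_between hK Ω.isOpen hKΩ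
  obtain ⟨f, hf, hr, hs, h1⟩ := exists_contMDiff_support_eq_eq_one_iff (n := ⊤)
    (modelWithCornersSelf ℝ (Cn n)) isOpen_interior hK.isClosed hKL
  have hsub : tsupport f ⊆ L :=
    hL.isClosed.closure_subset_iff.2 (hs ▸ interior_subset)
  let φ : 𝓓(Ω, ℝ) := ⟨f, hf.contDiff, hL.of_isClosed_subset (isClosed_tsupport f) hsub,
    hsub.trans hLΩ⟩
  refine ⟨TestFunction.postcompCLM Complex.ofRealCLM φ, fun x => ?_, fun x hx => ?_⟩
  · have : f x ∈ Set.Icc (0 : ℝ) 1 := hr ⟨x, rfl⟩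
    change 0 ≤ (f x : ℂ) ∧ (f x : ℂ) ≤ 1
    exact_mod_cast this
  · change (f x : ℂ) = 1
    exact_mod_cast (h1 x).1 hx

namespace Current11

lemma pair_add (T S : Current11 Ω) (Φ : TestForm Ω) :
    (T + S).pair Φ = T.pair Φ + S.pair Φ := by
  simp [pair, Finset.sum_add_distrib]

lemma pair_sub (T S : Current11 Ω) (Φ : TestForm Ω) :
    (T - S).pair Φ = T.pair Φ - S.pair Φ := by
  simp [pair, Finset.sum_sub_distrib]

lemma pair_smul (c : ℂ) (T : Current11 Ω) (Φ : TestForm Ω) :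
    (c • T).pair Φ = c * T.pair Φ := by
  simp [pair, Finset.mul_sum]

lemma pair_zero (Φ : TestForm Ω) : (0 : Current11 Ω).pair Φ = 0 := by
  simp [pair]

lemma pair_add_right (T : Current11 Ω) (Φ Ψ : TestForm Ω) :
    T.pair (Φ + Ψ) = T.pair Φ + T.pair Ψ := by
  simp [pair, Finset.sum_add_distrib]

lemma pair_smul_right (c : ℂ) (T : Current11 Ω) (Φ : TestForm Ω) :
    T.pair (c • Φ) = c * T.pair Φ := by
  simp [pair, Finset.mul_sum]

lemma IsPositive.add {T S : Current11 Ω} (hT : T.IsPositive) (hS : S.IsPositive) :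
    (T + S).IsPositive := fun Φ hΦ => by
  rw [pair_add]
  exact add_nonneg (hT Φ hΦ) (hS Φ hΦ)

lemma IsPositive.smul {T : Current11 Ω} (hT : T.IsPositive) {c : ℝ} (hc : 0 ≤ c) :
    ((c : ℂ) • T).IsPositive := fun Φ hΦ => by
  rw [pair_smul]
  exact mul_nonneg (Complex.zero_le_real.2 hc) (hT Φ hΦ)

lemma isPositive_zero : (0 : Current11 Ω).IsPositive := fun Φ _ => by
  rw [pair_zero]

lemma IsClosed.add {T S : Current11 Ω} (hT : T.IsClosed) (hS : S.IsClosed) :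
    (T + S).IsClosed := fun j k l φ => by
  have h1 := hT j k l φ
  have h2 := hS j k l φ
  simp [h1.1, h1.2, h2.1, h2.2]

lemma IsClosed.smul {T : Current11 Ω} (hT : T.IsClosed) (c : ℂ) : (c • T).IsClosed :=
  fun j k l φ => by
    have h1 := hT j k l φ
    simp [h1.1, h1.2]

lemma isClosed_zero : (0 : Current11 Ω).IsClosed := fun j k l φ => by
  simp

lemma le_mass (T : Current11 Ω) {χ : 𝓓(Ω, ℂ)} (hχ : ∀ x, 0 ≤ χ x ∧ χ x ≤ 1) :
    ENNReal.ofReal (T.pair (omegaForm χ)).re ≤ T.mass :=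
  le_iSup₂_of_le χ hχ le_rfl

lemma re_pair_omegaForm_le {T : Current11 Ω} (hm : T.mass < ⊤) {χ : 𝓓(Ω, ℂ)}
    (hχ : ∀ x, 0 ≤ χ x ∧ χ x ≤ 1) : (T.pair (omegaForm χ)).re ≤ T.mass.toReal :=
  (ENNReal.ofReal_le_iff_le_toReal hm.ne).1 (T.le_mass hχ)

lemma mass_add_le (T S : Current11 Ω) : (T + S).mass ≤ T.mass + S.mass := by
  refine iSup₂_le fun χ hχ => ?_
  rw [pair_add, Complex.add_re]
  exact ENNReal.ofReal_add_le.trans (add_le_add (T.le_mass hχ) (S.le_mass hχ))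

lemma mass_smul_le {c : ℝ} (hc : 0 ≤ c) (T : Current11 Ω) :
    ((c : ℂ) • T).mass ≤ ENNReal.ofReal c * T.mass := by
  refine iSup₂_le fun χ hχ => ?_
  rw [pair_smul, Complex.re_ofReal_mul, ENNReal.ofReal_mul hc]
  gcongr
  exact T.le_mass hχ

lemma mass_zero : (0 : Current11 Ω).mass = 0 := by
  simp [mass, pair_zero]

end Current11

/-! ### Control of the coefficients of a positive current by its mass -/

lemma omegaConst_pos (n : ℕ) : 0 < omegaConst n := by
  unfold omegaConst
  have := Real.pi_pos
  positivity

lemma posSemidef_of_forall_sum {M : Matrix (Fin n) (Fin n) ℂ} (hM : M.IsHermitian)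
    (h : ∀ x : Fin n → ℂ, 0 ≤ ∑ j, ∑ k, (starRingEnd ℂ) (x j) * M j k * x k) : M.PosSemidef := by
  refine .of_dotProduct_mulVec_nonneg hM fun x => ?_
  convert h x using 1
  simp [dotProduct, Matrix.mulVec, Finset.mul_sum, mul_assoc]

lemma sum_nonneg_of_posSemidef {M : Matrix (Fin n) (Fin n) ℂ} (hM : M.PosSemidef)
    (x : Fin n → ℂ) : 0 ≤ ∑ j, ∑ k, (starRingEnd ℂ) (x j) * M j k * x k := by
  convert hM.dotProduct_mulVec_nonneg x using 1
  simp [dotProduct, Matrix.mulVec, Finset.mul_sum, mul_assoc]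

lemma isStronglyPositive_omegaForm {χ : 𝓓(Ω, ℂ)} (hχ : ∀ x, 0 ≤ χ x) :
    (omegaForm χ).IsStronglyPositive := by
  intro x
  have : (Matrix.of fun j k : Fin n => omegaForm χ j k x)
      = Matrix.diagonal fun _ => (omegaConst n : ℂ) * χ x := by
    ext j k
    by_cases h : j = k <;> simp [omegaForm, h]
  rw [this]
  exact .diagonal fun _ => mul_nonneg (Complex.zero_le_real.2 (omegaConst_pos n).le) (hχ x)

/-- The complex conjugate of a test function. -/
def conjTest (φ : 𝓓(Ω, ℂ)) : 𝓓(Ω, ℂ) :=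
  TestFunction.postcompCLM (Complex.conjCLE : ℂ →L[ℝ] ℂ) φ

lemma conjTest_apply (φ : 𝓓(Ω, ℂ)) (x : Cn n) : conjTest φ x = (starRingEnd ℂ) (φ x) := rfl

/-- The form with entry `φ` at `(j, k)` and zero elsewhere. -/
def singleForm (j k : Fin n) (φ : 𝓓(Ω, ℂ)) : TestForm Ω :=
  fun a b => if a = j then if b = k then φ else 0 else 0

lemma pair_singleForm (T : Current11 Ω) (j k : Fin n) (φ : 𝓓(Ω, ℂ)) :
    T.pair (singleForm j k φ) = T j k φ := by
  rw [Current11.pair, Finset.sum_eq_single j, Finset.sum_eq_single k]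
  · simp [singleForm]
  · intro b _ hb
    simp [singleForm, hb]
  · simp
  · intro b _ hb
    simp [singleForm, hb]
  · simp

lemma sum_singleForm (j k : Fin n) (φ : 𝓓(Ω, ℂ)) (x : Cn n) (z : Fin n → ℂ) :
    ∑ a, ∑ b, (starRingEnd ℂ) (z a) * singleForm j k φ a b x * z b
      = (starRingEnd ℂ) (z j) * φ x * z k := by
  rw [Finset.sum_eq_single j, Finset.sum_eq_single k]
  · simp [singleForm]
  · intro b _ hb
    simp [singleForm, hb]
  · simp
  · intro b _ hb
    simp [singleForm, hb]
  · simp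

/-- The off-diagonal part contributes `2 Re(z̄_j φ z_k) ≥ -2Mχ|z_j||z_k| ≥ -2Mχ|z|²`. Since `χ
ω^{n-1}` has matrix `omegaConst n * χ` times the identity, the factor `2M / omegaConst n`
compensates exactly this loss, also when `j = k`. -/
lemma isStronglyPositive_add_singleForm {χ φ : 𝓓(Ω, ℂ)} {M : ℝ} (hχ : ∀ x, 0 ≤ χ x)
    (hφ : ∀ x, ‖φ x‖ ≤ M * (χ x).re) (j k : Fin n) :
    ((((2 * M / omegaConst n : ℝ) : ℂ) • omegaForm χ +
      (singleForm j k φ + singleForm k j (conjTest φ)) : TestForm Ω)).IsStronglyPositive := by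
  intro x
  have hre : χ x = ((χ x).re : ℂ) := by
    rw [← Complex.re_add_im (χ x), ← (Complex.nonneg_iff.1 (hχ x)).2]
    simp
  set r := (χ x).re with hr
  have hω : ∀ a b : Fin n, (((2 * M / omegaConst n : ℝ) : ℂ) • omegaForm χ) a b x
      = if a = b then ((2 * M * r : ℝ) : ℂ) else 0 := by
    intro a b
    by_cases h : a = b
    · simp [omegaForm, h, hre]
      have := (omegaConst_pos n).ne'
      field_simp
    · simp [omegaForm, h]
  have hentry : ∀ a b : Fin n, ((((2 * M / omegaConst n : ℝ) : ℂ) • omegaForm χ +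
      (singleForm j k φ + singleForm k j (conjTest φ)) : TestForm Ω)) a b x
      = (if a = b then ((2 * M * r : ℝ) : ℂ) else 0)
        + (singleForm j k φ a b x + singleForm k j (conjTest φ) a b x) := by
    intro a b
    rw [← hω]
    rfl
  apply posSemidef_of_forall_sum
  · ext a b
    rw [Matrix.conjTranspose_apply, Matrix.of_apply, Matrix.of_apply, hentry, hentry]
    have h1 : star (singleForm j k φ b a x) = singleForm k j (conjTest φ) a b x := by
      unfold singleForm
      split_ifs <;> simp [conjTest_apply]
    have h2 : star (singleForm k j (conjTest φ) b a x) = singleForm j k φ a b x := by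
      unfold singleForm
      split_ifs <;> simp [conjTest_apply]
    rw [star_add, star_add, h1, h2, add_comm (singleForm k j (conjTest φ) a b x)]
    congr 1
    by_cases h : a = b
    · simp [h]
    · simp [h, Ne.symm h]
  · intro z
    have hsum : ∑ a, ∑ b, (starRingEnd ℂ) (z a) *
        (Matrix.of fun a b => ((((2 * M / omegaConst n : ℝ) : ℂ) • omegaForm χ +
          (singleForm j k φ + singleForm k j (conjTest φ)) : TestForm Ω)) a b x) a b * z b
        = ((2 * M * r * ∑ a, ‖z a‖ ^ 2 + 2 * ((starRingEnd ℂ) (z j) * φ x * z k).re : ℝ) : ℂ) := by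
      simp only [Matrix.of_apply, hentry, mul_add, add_mul, Finset.sum_add_distrib, sum_singleForm]
      push_cast
      congr 1
      · simp only [mul_ite, mul_zero, ite_mul, zero_mul, Finset.sum_ite_eq, Finset.mem_univ,
          if_true, Finset.mul_sum]
        refine Finset.sum_congr rfl fun a _ => ?_
        rw [← Complex.conj_mul']
        ring
      · have := Complex.add_conj ((starRingEnd ℂ) (z j) * φ x * z k)
        push_cast at this
        rw [← this, conjTest_apply]
        simp only [map_mul, Complex.conj_conj]
        ring
    rw [hsum, Complex.zero_le_real]
    have h1 : -(‖z j‖ * (M * r) * ‖z k‖) ≤ ((starRingEnd ℂ) (z j) * φ x * z k).re := by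
      refine (neg_le_neg ?_).trans (abs_le.1 (Complex.abs_re_le_norm _)).1
      rw [norm_mul, norm_mul, RCLike.norm_conj]
      gcongr
      exact hφ x
    have hMr : 0 ≤ M * r := (norm_nonneg _).trans (hφ x)
    have h2 : ∀ a, ‖z a‖ ^ 2 ≤ ∑ a, ‖z a‖ ^ 2 := fun a =>
      Finset.single_le_sum (f := fun a => ‖z a‖ ^ 2) (fun _ _ => by positivity) (Finset.mem_univ a)
    have h3 : ‖z j‖ * ‖z k‖ ≤ ∑ a, ‖z a‖ ^ 2 := by
      nlinarith [h2 j, h2 k, sq_nonneg (‖z j‖ - ‖z k‖)]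
    nlinarith [mul_le_mul_of_nonneg_left h3 hMr]

lemma norm_le_re_of_nonneg_add_sub {a b : ℂ} (h : 0 ≤ a + b) (h' : 0 ≤ a - b) : ‖b‖ ≤ a.re := by
  rw [Complex.nonneg_iff] at h h'
  simp only [Complex.add_re, Complex.add_im, Complex.sub_re, Complex.sub_im] at h h'
  have him : b.im = 0 := by linarith [h.2, h'.2]
  have : b = (b.re : ℂ) := by
    apply Complex.ext <;> simp [him]
  rw [this, Complex.norm_real, Real.norm_eq_abs, abs_le]
  constructor <;> linarith [h.1, h'.1]

lemma singleForm_neg (j k : Fin n) (φ : 𝓓(Ω, ℂ)) :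
    singleForm j k (-φ) = (-1 : ℂ) • singleForm j k φ := by
  funext a b
  simp only [singleForm, Pi.smul_apply]
  split_ifs <;> simp

/-- The coefficients of a positive current of finite mass are controlled by the mass. -/
lemma Current11.IsPositive.norm_apply_le {T : Current11 Ω} (hT : T.IsPositive) (hm : T.mass < ⊤)
    (j k : Fin n) {φ : 𝓓(Ω, ℂ)} {M : ℝ} (hM : ∀ x, ‖φ x‖ ≤ M) :
    ‖T j k φ‖ ≤ 2 * M / omegaConst n * T.mass.toReal := by
  obtain ⟨χ, hχ, hχ1⟩ := exists_cutoff φ.hasCompactSupport φ.tsupport_subset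
  have hM0 : 0 ≤ M := (norm_nonneg _).trans (hM 0)
  have hχM : ∀ x, ‖φ x‖ ≤ M * (χ x).re := by
    intro x
    by_cases hx : x ∈ tsupport φ
    · simpa [hχ1 x hx] using hM x
    · rw [image_eq_zero_of_notMem_tsupport hx, norm_zero]
      exact mul_nonneg hM0 (Complex.nonneg_iff.1 (hχ x).1).1
  -- Positivity is tested on the perturbed multiple of `χ ω^{n-1}` with both signs of `ψ`.
  have key : ∀ ψ : 𝓓(Ω, ℂ), (∀ x, ‖ψ x‖ ≤ M * (χ x).re) →
      ‖T j k ψ + T k j (conjTest ψ)‖ ≤ 2 * M / omegaConst n * T.mass.toReal := by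
    intro ψ hψ
    have h1 := hT _ (isStronglyPositive_add_singleForm (fun x => (hχ x).1) hψ j k)
    have h2 := hT _ (isStronglyPositive_add_singleForm (φ := -ψ) (fun x => (hχ x).1)
      (by simpa using hψ) j k)
    have hc : conjTest (-ψ) = -conjTest ψ := by
      ext x
      simp [conjTest_apply]
    rw [hc, singleForm_neg, singleForm_neg, ← smul_add] at h2
    simp only [pair_add_right, pair_smul_right, pair_singleForm] at h1 h2
    rw [neg_one_mul, ← sub_eq_add_neg] at h2
    refine (norm_le_re_of_nonneg_add_sub h1 h2).trans ?_
    rw [Complex.re_ofReal_mul]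
    gcongr
    · have := omegaConst_pos n
      positivity
    · exact re_pair_omegaForm_le hm hχ
  -- Using `φ` and `i φ` bounds both the sum and the difference of `T j k φ` and `T k j (conjTest
  -- φ)`. Their average is `T j k φ`, so Hermitian symmetry of `T` is not needed.
  have h1 := key φ hχM
  have h2 := key (Complex.I • φ) (by simpa using hχM)
  have hc : conjTest (Complex.I • φ) = (-Complex.I) • conjTest φ := by
    ext x
    simp [conjTest_apply]
  have h3 : T j k (Complex.I • φ) + T k j (conjTest (Complex.I • φ))
      = Complex.I * (T j k φ - T k j (conjTest φ)) := by
    rw [hc, map_smul, map_smul, smul_eq_mul, smul_eq_mul]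
    ring
  rw [h3, norm_mul, Complex.norm_I, one_mul] at h2
  have h4 : (2 : ℂ) * T j k φ
      = (T j k φ + T k j (conjTest φ)) + (T j k φ - T k j (conjTest φ)) := by ring
  have h5 : ‖(2 : ℂ) * T j k φ‖ ≤ _ := h4 ▸ norm_add_le _ _
  rw [norm_mul, Complex.norm_ofNat] at h5
  linarith

/-- A series of positive currents whose masses are summable converges. -/
lemma exists_hasSum_current {S : ℕ → Current11 Ω} (hS : ∀ i, (S i).IsPositive)
    {b : ℕ → ℝ} (hb : ∀ i, (S i).mass ≤ ENNReal.ofReal (b i)) (hb0 : ∀ i, 0 ≤ b i)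
    (hsum : Summable b) :
    ∃ T : Current11 Ω, ∀ j k φ, HasSum (fun i => S i j k φ) (T j k φ) := by
  have hfin : ∀ i, (S i).mass < ⊤ := fun i => (hb i).trans_lt ENNReal.ofReal_lt_top
  have hbound : ∀ i j k (φ : 𝓓(Ω, ℂ)), ‖S i j k φ‖ ≤
      2 * ‖TestFunction.toBoundedContinuousFunctionCLM ℂ φ‖ / omegaConst n * b i := by
    intro i j k φ
    refine ((hS i).norm_apply_le (hfin i) j k (φ := φ) fun x =>
      (TestFunction.toBoundedContinuousFunctionCLM ℂ φ).norm_coe_le_norm x).trans ?_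
    have := omegaConst_pos n
    gcongr
    exact ENNReal.toReal_le_of_le_ofReal (hb0 i) (hb i)
  have hsumm : ∀ j k (φ : 𝓓(Ω, ℂ)), Summable fun i => S i j k φ := fun j k φ =>
    Summable.of_norm_bounded (hsum.mul_left _) (fun i => hbound i j k φ)
  let L : Fin n → Fin n → 𝓓(Ω, ℂ) →ₗ[ℂ] ℂ := fun j k =>
    { toFun := fun φ => ∑' i, S i j k φ
      map_add' := fun φ ψ => by
        simp only [map_add]
        exact (hsumm j k φ).tsum_add (hsumm j k ψ)
      map_smul' := fun c φ => by
        simp only [map_smul, smul_eq_mul, RingHom.id_apply]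
        exact tsum_mul_left }
  have hL : ∀ j k, Continuous (L j k) := by
    intro j k
    -- The bound by the mass involves only the sup norm of `φ`, which is continuous on test
    -- functions, so the summed functional is continuous at `0`.
    refine continuous_of_continuousAt_zero (L j k) ?_
    have hle : ∀ φ : 𝓓(Ω, ℂ), ‖L j k φ‖ ≤
        2 * ‖TestFunction.toBoundedContinuousFunctionCLM ℂ φ‖ / omegaConst n * ∑' i, b i := by
      intro φ
      rw [← tsum_mul_left]
      exact tsum_of_norm_bounded (hsum.mul_left _).hasSum (fun i => hbound i j k φ)
    rw [ContinuousAt, map_zero]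
    refine squeeze_zero_norm hle ?_
    have hc : Continuous fun φ : 𝓓(Ω, ℂ) =>
        2 * ‖TestFunction.toBoundedContinuousFunctionCLM ℂ φ‖ / omegaConst n * ∑' i, b i := by
      fun_prop
    simpa only [map_zero, norm_zero, mul_zero, zero_div, zero_mul] using hc.tendsto 0
  exact ⟨fun j k => ⟨L j k, hL j k⟩, fun j k φ => (hsumm j k φ).hasSum⟩

lemma hasSum_pair {S : ℕ → Current11 Ω} {T : Current11 Ω}
    (h : ∀ j k φ, HasSum (fun i => S i j k φ) (T j k φ)) (Φ : TestForm Ω) :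
    HasSum (fun i => (S i).pair Φ) (T.pair Φ) :=
  hasSum_sum fun j _ => hasSum_sum fun k _ => h j k (Φ j k)

/-- For each fixed cutoff the pairing is summed termwise; the supremum over cutoffs is taken only
afterwards. -/
lemma mass_le_of_hasSum {S : ℕ → Current11 Ω} {T : Current11 Ω}
    (h : ∀ j k φ, HasSum (fun i => S i j k φ) (T j k φ)) {b : ℕ → ℝ} (hb0 : ∀ i, 0 ≤ b i)
    (hb : ∀ i, (S i).mass ≤ ENNReal.ofReal (b i)) (hsum : Summable b) :
    T.mass ≤ ENNReal.ofReal (∑' i, b i) := by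
  refine iSup₂_le fun χ hχ => ENNReal.ofReal_le_ofReal ?_
  have hre := Complex.hasSum_re (hasSum_pair h (omegaForm χ))
  rw [← hre.tsum_eq]
  exact hre.summable.tsum_le_tsum (fun i =>
    (ENNReal.ofReal_le_ofReal_iff (hb0 i)).1 (((S i).le_mass hχ).trans (hb i))) hsum

lemma isClosed_of_hasSum {S : ℕ → Current11 Ω} {T : Current11 Ω}
    (h : ∀ j k φ, HasSum (fun i => S i j k φ) (T j k φ)) (hS : ∀ i, (S i).IsClosed) :
    T.IsClosed := fun j k l φ => by
  constructor
  · refine (h j k _).unique ?_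
    simpa only [fun i => (hS i j k l φ).1] using h l k _
  · refine (h j k _).unique ?_
    simpa only [fun i => (hS i j k l φ).2] using h j l _

/-! ### The current `df ∧ d^c f` -/

lemma memLp_wirtinger (f : L2 Ω) (j : Fin n) :
    MemLp (wirtinger f j) 2 ((volume : Measure (Cn n)).restrict (Ω : Set (Cn n))) :=
  ((Lp.memLp (weakDeriv f (dirX j))).ofReal.sub
    ((Lp.memLp (weakDeriv f (dirY j))).ofReal.const_mul Complex.I)).const_mul (1 / 2 : ℂ)

lemma integrable_wirtinger_mul (f : L2 Ω) (j k : Fin n) :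
    Integrable (fun x => wirtinger f j x * (starRingEnd ℂ) (wirtinger f k x))
      ((volume : Measure (Cn n)).restrict (Ω : Set (Cn n))) :=
  (memLp_wirtinger f j).integrable_mul (memLp_wirtinger f k).star

lemma integrable_testFunction_mul (φ : 𝓓(Ω, ℂ)) (f : L2 Ω) (j k : Fin n) :
    Integrable (fun x => φ x * (wirtinger f j x * (starRingEnd ℂ) (wirtinger f k x)))
      ((volume : Measure (Cn n)).restrict (Ω : Set (Cn n))) :=
  TestFunction.integrable_bilin (ContinuousLinearMap.mul ℂ ℂ)
    ((integrable_wirtinger_mul f j k).locallyIntegrable.locallyIntegrableOn _) φ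

lemma dfdcf_apply (f : L2 Ω) (j k : Fin n) (φ : 𝓓(Ω, ℂ)) :
    dfdcf f j k φ = ∫ x in (Ω : Set (Cn n)),
      φ x * (wirtinger f j x * (starRingEnd ℂ) (wirtinger f k x)) :=
  TestFunction.integralAgainstBilinCLM_eq_integral
    ((integrable_wirtinger_mul f j k).locallyIntegrable.locallyIntegrableOn _)

/-- The Hermitian form `∑ Φ_{jk} w_j w̄_k`. -/
def hermForm (Φ : TestForm Ω) (x : Cn n) (w : Fin n → ℂ) : ℂ :=
  ∑ j, ∑ k, Φ j k x * (w j * (starRingEnd ℂ) (w k))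

lemma hermForm_nonneg {Φ : TestForm Ω} (hΦ : Φ.IsStronglyPositive) (x : Cn n) (w : Fin n → ℂ) :
    0 ≤ hermForm Φ x w := by
  convert sum_nonneg_of_posSemidef (hΦ x) (fun j => (starRingEnd ℂ) (w j)) using 1
  refine Finset.sum_congr rfl fun j _ => Finset.sum_congr rfl fun k _ => ?_
  simp only [Matrix.of_apply, Complex.conj_conj]
  ring

/-- The coefficient `(s * t)⁻¹` is the one that cancels the cross terms in `w` and `v`. When the
form is nonnegative, dropping the second term leaves the weighted Cauchy-Schwarz inequality. -/
lemma hermForm_parallelogram (Φ : TestForm Ω) (x : Cn n) (w v : Fin n → ℂ) {s t : ℝ}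
    (hs : s ≠ 0) (ht : t ≠ 0) :
    hermForm Φ x (w + v) + (((s * t)⁻¹ : ℝ) : ℂ) * hermForm Φ x ((t : ℂ) • w - (s : ℂ) • v)
      = (((s + t) / s : ℝ) : ℂ) * hermForm Φ x w + (((s + t) / t : ℝ) : ℂ) * hermForm Φ x v := by
  simp only [hermForm, Finset.mul_sum, ← Finset.sum_add_distrib]
  refine Finset.sum_congr rfl fun j _ => Finset.sum_congr rfl fun k _ => ?_
  have hs' : (s : ℂ) ≠ 0 := Complex.ofReal_ne_zero.2 hs
  have ht' : (t : ℂ) ≠ 0 := Complex.ofReal_ne_zero.2 ht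
  simp only [Pi.add_apply, Pi.sub_apply, Pi.smul_apply, smul_eq_mul, map_add, map_sub, map_mul,
    Complex.conj_ofReal]
  push_cast
  field_simp
  ring

lemma integrable_hermForm (Φ : TestForm Ω) (f : L2 Ω) :
    Integrable (fun x => hermForm Φ x fun j => wirtinger f j x)
      ((volume : Measure (Cn n)).restrict (Ω : Set (Cn n))) :=
  integrable_finsetSum _ fun j _ => integrable_finsetSum _ fun k _ =>
    integrable_testFunction_mul (Φ j k) f j k

lemma pair_dfdcf (f : L2 Ω) (Φ : TestForm Ω) :
    (dfdcf f).pair Φ = ∫ x in (Ω : Set (Cn n)), hermForm Φ x fun j => wirtinger f j x := by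
  simp only [Current11.pair, dfdcf_apply, hermForm]
  rw [integral_finsetSum _ fun j _ => integrable_finsetSum _ fun k _ =>
    integrable_testFunction_mul (Φ j k) f j k]
  refine Finset.sum_congr rfl fun j _ => ?_
  rw [integral_finsetSum _ fun k _ => integrable_testFunction_mul (Φ j k) f j k]

lemma isPositive_dfdcf (f : L2 Ω) : (dfdcf f).IsPositive := fun Φ hΦ => by
  rw [pair_dfdcf]
  exact integral_nonneg_of_ae (.of_forall fun x => hermForm_nonneg hΦ x _)

lemma wirtinger_combination {f g : L2 Ω} (hf : f ∈ W12 Ω) (hg : g ∈ W12 Ω) (s t : ℝ) :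
    ∀ᵐ x ∂((volume : Measure (Cn n)).restrict (Ω : Set (Cn n))),
      (fun j => wirtinger (s • f + t • g) j x)
        = (s : ℂ) • (fun j => wirtinger f j x) + (t : ℂ) • fun j => wirtinger g j x := by
  have key : ∀ v : Cn n, ∀ᵐ x ∂((volume : Measure (Cn n)).restrict (Ω : Set (Cn n))),
      weakDeriv (s • f + t • g) v x = s * weakDeriv f v x + t * weakDeriv g v x := by
    intro v
    rw [weakDeriv_add ((W12Sub Ω).smul_mem s hf) ((W12Sub Ω).smul_mem t hg),
      weakDeriv_smul s hf, weakDeriv_smul t hg]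
    filter_upwards [Lp.coeFn_add (s • weakDeriv f v) (t • weakDeriv g v),
      Lp.coeFn_smul s (weakDeriv f v), Lp.coeFn_smul t (weakDeriv g v)] with x h1 h2 h3
    rw [h1, Pi.add_apply, h2, h3]
    rfl
  have hX := ae_all_iff.2 fun j : Fin n => key (dirX j)
  have hY := ae_all_iff.2 fun j : Fin n => key (dirY j)
  filter_upwards [hX, hY] with x h1 h2
  funext j
  simp only [wirtinger, h1 j, h2 j, Pi.add_apply, Pi.smul_apply, smul_eq_mul]
  push_cast
  ring

lemma dfdcf_smul {f : L2 Ω} (c : ℝ) (hf : f ∈ W12 Ω) :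
    dfdcf (c • f) = ((c ^ 2 : ℝ) : ℂ) • dfdcf f := by
  funext j k
  ext φ
  rw [Pi.smul_apply, Pi.smul_apply, smul_apply, dfdcf_apply, dfdcf_apply,
    smul_eq_mul, ← integral_const_mul]
  refine integral_congr_ae ?_
  filter_upwards [wirtinger_combination hf hf c 0] with x hx
  rw [zero_smul, add_zero] at hx
  have hx' := fun j => congrFun hx j
  simp only [Complex.ofReal_zero, zero_smul, add_zero, Pi.smul_apply, smul_eq_mul] at hx'
  rw [hx' j, hx' k, map_mul, Complex.conj_ofReal]
  push_cast
  ring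

lemma pair_dfdcf_parallelogram {f g : L2 Ω} (hf : f ∈ W12 Ω) (hg : g ∈ W12 Ω) {s t : ℝ}
    (hs : s ≠ 0) (ht : t ≠ 0) (Φ : TestForm Ω) :
    (dfdcf (f + g)).pair Φ + (((s * t)⁻¹ : ℝ) : ℂ) * (dfdcf (t • f + (-s) • g)).pair Φ
      = (((s + t) / s : ℝ) : ℂ) * (dfdcf f).pair Φ
        + (((s + t) / t : ℝ) : ℂ) * (dfdcf g).pair Φ := by
  simp only [pair_dfdcf, ← integral_const_mul]
  rw [← integral_add (integrable_hermForm Φ _) ((integrable_hermForm Φ _).const_mul _),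
    ← integral_add ((integrable_hermForm Φ _).const_mul _) ((integrable_hermForm Φ _).const_mul _)]
  refine integral_congr_ae ?_
  filter_upwards [wirtinger_combination hf hg 1 1, wirtinger_combination hf hg t (-s)]
    with x h1 h2
  rw [one_smul, one_smul, Complex.ofReal_one, one_smul, one_smul] at h1
  rw [h1, h2, ← hermForm_parallelogram Φ x _ _ hs ht]
  rw [Complex.ofReal_neg, neg_smul, ← sub_eq_add_neg]

/-- The weighted Cauchy-Schwarz inequality for `df ∧ d^c f`. -/
lemma pair_dfdcf_add_le {f g : L2 Ω} (hf : f ∈ W12 Ω) (hg : g ∈ W12 Ω) {s t : ℝ}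
    (hs : 0 < s) (ht : 0 < t) {Φ : TestForm Ω} (hΦ : Φ.IsStronglyPositive) :
    (dfdcf (f + g)).pair Φ ≤ (((s + t) / s : ℝ) : ℂ) * (dfdcf f).pair Φ
      + (((s + t) / t : ℝ) : ℂ) * (dfdcf g).pair Φ := by
  rw [← pair_dfdcf_parallelogram hf hg hs.ne' ht.ne' Φ]
  refine le_add_of_nonneg_right (mul_nonneg ?_ (isPositive_dfdcf _ Φ hΦ))
  rw [Complex.zero_le_real]
  positivity

/-! ### The gradient integral and the mass -/

lemma norm_sq_wirtinger (f : L2 Ω) (j : Fin n) (x : Cn n) :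
    ‖wirtinger f j x‖ ^ 2 =
      1 / 4 * (weakDeriv f (dirX j) x ^ 2 + weakDeriv f (dirY j) x ^ 2) := by
  rw [← Complex.normSq_eq_norm_sq, wirtinger, Complex.normSq_apply]
  simp
  ring

lemma norm_sq_eq_integral (g : L2 Ω) : ‖g‖ ^ 2 = ∫ x in (Ω : Set (Cn n)), g x ^ 2 := by
  rw [← real_inner_self_eq_norm_sq, L2.inner_def]
  refine integral_congr_ae (.of_forall fun x => ?_)
  simp

lemma integrable_norm_sq_wirtinger (f : L2 Ω) (j : Fin n) :
    Integrable (fun x => ‖wirtinger f j x‖ ^ 2)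
      ((volume : Measure (Cn n)).restrict (Ω : Set (Cn n))) :=
  (memLp_wirtinger f j).integrable_norm_pow (by norm_num)

lemma integral_sum_norm_sq_wirtinger (f : L2 Ω) :
    ∫ x in (Ω : Set (Cn n)), ∑ j, ‖wirtinger f j x‖ ^ 2 = gradSq f / 4 := by
  rw [integral_finsetSum _ fun j _ => integrable_norm_sq_wirtinger f j, gradSq, Finset.sum_div]
  refine Finset.sum_congr rfl fun j _ => ?_
  simp only [norm_sq_wirtinger]
  rw [integral_const_mul, integral_add (Lp.memLp _).integrable_sq (Lp.memLp _).integrable_sq,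
    norm_sq_eq_integral, norm_sq_eq_integral]
  ring

/-- Pointwise, `|w_j w̄_k| ≤ |w|²`, so the sup norms of the coefficients of `Φ` give the constant.
This makes the pairing of a remainder vanish in the limit along a series converging in `W^{1,2}`. -/
lemma exists_norm_pair_dfdcf_le (Φ : TestForm Ω) :
    ∃ C, ∀ f : L2 Ω, ‖(dfdcf f).pair Φ‖ ≤ C * gradSq f := by
  let M : ℝ := ∑ j, ∑ k, ‖TestFunction.toBoundedContinuousFunctionCLM ℂ (Φ j k)‖
  refine ⟨M / 4, fun f => ?_⟩
  rw [pair_dfdcf, div_mul_eq_mul_div, mul_div_assoc, ← integral_sum_norm_sq_wirtinger,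
    ← integral_const_mul]
  refine norm_integral_le_of_norm_le ((integrable_finsetSum _ fun j _ =>
    integrable_norm_sq_wirtinger f j).const_mul M) (.of_forall fun x => ?_)
  refine (norm_sum_le _ _).trans ?_
  rw [Finset.sum_mul]
  refine Finset.sum_le_sum fun j _ => (norm_sum_le _ _).trans ?_
  rw [Finset.sum_mul]
  refine Finset.sum_le_sum fun k _ => ?_
  rw [norm_mul]
  refine mul_le_mul ((TestFunction.toBoundedContinuousFunctionCLM ℂ (Φ j k)).norm_coe_le_norm x) ?_
    (norm_nonneg _) (norm_nonneg _)
  rw [norm_mul, RCLike.norm_conj]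
  have h2 : ∀ a, ‖wirtinger f a x‖ ^ 2 ≤ ∑ a, ‖wirtinger f a x‖ ^ 2 := fun a =>
    Finset.single_le_sum (f := fun a => ‖wirtinger f a x‖ ^ 2) (fun _ _ => by positivity)
      (Finset.mem_univ a)
  nlinarith [h2 j, h2 k, sq_nonneg (‖wirtinger f j x‖ - ‖wirtinger f k x‖)]

lemma hermForm_omegaForm (χ : 𝓓(Ω, ℂ)) (x : Cn n) (w : Fin n → ℂ) :
    hermForm (omegaForm χ) x w = χ x * ((omegaConst n * ∑ j, ‖w j‖ ^ 2 : ℝ) : ℂ) := by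
  have h : ∀ j k, omegaForm χ j k x = if j = k then (omegaConst n : ℂ) * χ x else 0 := by
    intro j k
    by_cases h : j = k <;> simp [omegaForm, h]
  simp only [hermForm, h, ite_mul, zero_mul, Finset.sum_ite_eq, Finset.mem_univ, if_true,
    Complex.mul_conj']
  push_cast
  rw [Finset.mul_sum, Finset.mul_sum]
  refine Finset.sum_congr rfl fun j _ => ?_
  ring

/-- Integrals over `Ω` are limits of integrals against cutoff functions. -/
lemma exists_cutoff_tendsto (h : Cn n → ℂ)
    (hh : Integrable h ((volume : Measure (Cn n)).restrict (Ω : Set (Cn n)))) :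
    ∃ χ : ℕ → 𝓓(Ω, ℂ), (∀ i x, 0 ≤ χ i x ∧ χ i x ≤ 1) ∧
      Filter.Tendsto (fun i => ∫ x in (Ω : Set (Cn n)), χ i x * h x) .atTop
        (nhds (∫ x in (Ω : Set (Cn n)), h x)) := by
  obtain ⟨K, hK⟩ : ∃ K : ℕ → Set (Cn n), (∀ i, IsCompact (K i) ∧ K i ⊆ Ω) ∧
      ∀ x ∈ Ω, ∀ᶠ i in .atTop, x ∈ K i := by
    have : LocallyCompactSpace Ω := Ω.isOpen.locallyCompactSpace
    refine ⟨fun i => Subtype.val '' compactCovering Ω i, fun i =>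
      ⟨(isCompact_compactCovering Ω i).image continuous_subtype_val, ?_⟩, fun x hx => ?_⟩
    · rintro _ ⟨y, _, rfl⟩
      exact y.2
    · obtain ⟨i, hi⟩ := exists_mem_compactCovering (⟨x, hx⟩ : Ω)
      filter_upwards [Filter.eventually_ge_atTop i] with k hk
      exact ⟨⟨x, hx⟩, compactCovering_subset Ω hk hi, rfl⟩
  choose χ hχ hχ1 using fun i => exists_cutoff (hK.1 i).1 (hK.1 i).2
  refine ⟨χ, hχ, tendsto_integral_of_dominated_convergence (fun x => ‖h x‖) (fun i => ?_)
    hh.norm (fun i => .of_forall fun x => ?_) ?_⟩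
  · exact (χ i).aestronglyMeasurable.mul hh.aestronglyMeasurable
  · rw [norm_mul]
    refine mul_le_of_le_one_left (norm_nonneg _) ?_
    have := CStarAlgebra.norm_le_norm_of_nonneg_of_le (hχ i x).1 (hχ i x).2
    simpa using this
  · filter_upwards [ae_restrict_mem Ω.isOpen.measurableSet] with x hx
    refine tendsto_const_nhds.congr' ?_
    filter_upwards [hK.2 x hx] with i hi
    rw [hχ1 i x hi, one_mul]

/-- Pair `T - dfdcf f` with `χ_i ω^{n-1}` for cutoffs `χ_i` tending to `1` on `Ω`. The limit of the
pairings of `dfdcf f` is `omegaConst n * ∫ ∑ |∂f/∂z_j|²`, and `∑ |∂f/∂z_j|² = |∇f|² / 4`. -/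
lemma mass_ge_of_sub_isPositive {f : L2 Ω} {T : Current11 Ω}
    (hT : Current11.IsPositive (T - dfdcf f)) :
    ENNReal.ofReal (omegaConst n / 4 * gradSq f) ≤ T.mass := by
  have hint : Integrable (fun x => ((omegaConst n * ∑ j, ‖wirtinger f j x‖ ^ 2 : ℝ) : ℂ))
      ((volume : Measure (Cn n)).restrict (Ω : Set (Cn n))) :=
    ((integrable_finsetSum _ fun j _ => integrable_norm_sq_wirtinger f j).const_mul _).ofReal
  obtain ⟨χ, hχ, hlim⟩ := exists_cutoff_tendsto _ hint
  have hval : ∫ x in (Ω : Set (Cn n)), ((omegaConst n * ∑ j, ‖wirtinger f j x‖ ^ 2 : ℝ) : ℂ)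
      = ((omegaConst n / 4 * gradSq f : ℝ) : ℂ) := by
    rw [integral_complex_ofReal, integral_const_mul, integral_sum_norm_sq_wirtinger]
    congr 1
    ring
  rw [hval] at hlim
  have hlim' := (ENNReal.continuous_ofReal.comp Complex.continuous_re).tendsto _ |>.comp hlim
  refine le_of_tendsto hlim' (.of_forall fun i => ?_)
  refine le_trans ?_ (T.le_mass (hχ i))
  have h1 := hT _ (isStronglyPositive_omegaForm fun x => (hχ i x).1)
  rw [Current11.pair_sub, sub_nonneg, pair_dfdcf] at h1
  simp only [hermForm_omegaForm] at h1
  exact ENNReal.ofReal_le_ofReal (Complex.le_def.1 h1).1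

/-! ### The space `W^*(Ω)` and its norm -/

lemma mem_Gam_add {f g : L2 Ω} (hf : f ∈ W12 Ω) (hg : g ∈ W12 Ω) {T S : Current11 Ω}
    (hT : T ∈ Gam f) (hS : S ∈ Gam g) {s t : ℝ} (hs : 0 < s) (ht : 0 < t) :
    (((s + t) / s : ℝ) : ℂ) • T + (((s + t) / t : ℝ) : ℂ) • S ∈ Gam (f + g) := by
  have h1 : 0 ≤ (s + t) / s := by positivity
  have h2 : 0 ≤ (s + t) / t := by positivity
  refine ⟨(hT.1.smul h1).add (hS.1.smul h2), (hT.2.1.smul _).add (hS.2.1.smul _),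
    fun Φ hΦ => ?_⟩
  have h3 := hT.2.2 Φ hΦ
  have h4 := hS.2.2 Φ hΦ
  simp only [Current11.pair_sub, Current11.pair_add, Current11.pair_smul, sub_nonneg] at *
  exact (pair_dfdcf_add_le hf hg hs ht hΦ).trans (add_le_add
    (mul_le_mul_of_nonneg_left h3 (Complex.zero_le_real.2 h1))
    (mul_le_mul_of_nonneg_left h4 (Complex.zero_le_real.2 h2)))

lemma mem_Gam_smul {f : L2 Ω} (hf : f ∈ W12 Ω) {T : Current11 Ω} (hT : T ∈ Gam f) (c : ℝ) :
    ((c ^ 2 : ℝ) : ℂ) • T ∈ Gam (c • f) := by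
  refine ⟨hT.1.smul (sq_nonneg c), hT.2.1.smul _, fun Φ hΦ => ?_⟩
  rw [dfdcf_smul c hf, Current11.pair_sub, Current11.pair_smul, Current11.pair_smul, ← mul_sub,
    ← Current11.pair_sub]
  exact mul_nonneg (Complex.zero_le_real.2 (sq_nonneg c)) (hT.2.2 Φ hΦ)

lemma dfdcf_zero : dfdcf (0 : L2 Ω) = 0 := by
  have h := dfdcf_smul (Ω := Ω) 0 (W12Sub Ω).zero_mem
  rw [smul_zero] at h
  rw [h]
  funext j k
  ext φ
  simp

lemma zero_mem_Gam : (0 : Current11 Ω) ∈ Gam (0 : L2 Ω) :=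
  ⟨Current11.isPositive_zero, Current11.isClosed_zero, by
    rw [dfdcf_zero, sub_zero]
    exact Current11.isPositive_zero⟩

variable (Ω) in
/-- `W^*(Ω)` as a subspace of `L²(Ω, ℝ)`. -/
def WStarSub : Submodule ℝ (L2 Ω) where
  carrier := WStar Ω
  zero_mem' := ⟨(W12Sub Ω).zero_mem, 0, zero_mem_Gam, by simp [Current11.mass_zero]⟩
  add_mem' := by
    rintro f g ⟨hf, T, hT, hTm⟩ ⟨hg, S, hS, hSm⟩
    refine ⟨(W12Sub Ω).add_mem hf hg, _, mem_Gam_add hf hg hT hS one_pos one_pos, ?_⟩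
    refine (Current11.mass_add_le _ _).trans_lt (ENNReal.add_lt_top.2 ⟨?_, ?_⟩)
    · exact (Current11.mass_smul_le (by norm_num) T).trans_lt
        (ENNReal.mul_lt_top ENNReal.ofReal_lt_top hTm)
    · exact (Current11.mass_smul_le (by norm_num) S).trans_lt
        (ENNReal.mul_lt_top ENNReal.ofReal_lt_top hSm)
  smul_mem' := by
    rintro c f ⟨hf, T, hT, hTm⟩
    exact ⟨(W12Sub Ω).smul_mem c hf, _, mem_Gam_smul hf hT c,
      (Current11.mass_smul_le (sq_nonneg c) T).trans_lt
        (ENNReal.mul_lt_top ENNReal.ofReal_lt_top hTm)⟩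

/-- The least mass of a current in `Γ_f`. -/
def starMass (f : L2 Ω) : ℝ := (⨅ T ∈ Gam f, T.mass).toReal

lemma starMass_nonneg (f : L2 Ω) : 0 ≤ starMass f := ENNReal.toReal_nonneg

lemma starMass_le {f : L2 Ω} {T : Current11 Ω} (hT : T ∈ Gam f) {b : ℝ} (hb : 0 ≤ b)
    (hm : T.mass ≤ ENNReal.ofReal b) : starMass f ≤ b :=
  ENNReal.toReal_le_of_le_ofReal hb ((iInf₂_le T hT).trans hm)

lemma iInf_mass_lt_top {f : L2 Ω} (hf : f ∈ WStar Ω) : ⨅ T ∈ Gam f, T.mass < ⊤ := by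
  obtain ⟨_, T, hT, hm⟩ := hf
  exact (iInf₂_le T hT).trans_lt hm

lemma exists_mass_le {f : L2 Ω} (hf : f ∈ WStar Ω) {b : ℝ} (hb : starMass f < b) :
    ∃ T ∈ Gam f, T.mass ≤ ENNReal.ofReal b := by
  have h := (ENNReal.lt_ofReal_iff_toReal_lt (iInf_mass_lt_top hf).ne).2 hb
  simp only [iInf_lt_iff] at h
  obtain ⟨T, hT, hm⟩ := h
  exact ⟨T, hT, hm.le⟩

lemma gradSq_le_starMass {f : L2 Ω} (hf : f ∈ WStar Ω) :
    omegaConst n / 4 * gradSq f ≤ starMass f := by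
  rw [starMass, ← ENNReal.ofReal_le_iff_le_toReal (iInf_mass_lt_top hf).ne]
  exact le_iInf₂ fun T hT => mass_ge_of_sub_isPositive hT.2.2

/-- If the masses are at most `a²` and `b²`, the weights `s = a`, `t = b` give mass at most `(a+b)/a
* a² + (a+b)/b * b² = (a+b)²`. -/
lemma sqrt_starMass_add_le {f g : L2 Ω} (hf : f ∈ WStar Ω) (hg : g ∈ WStar Ω) :
    √(starMass (f + g)) ≤ √(starMass f) + √(starMass g) := by
  refine le_of_forall_pos_le_add fun ε hε => ?_
  -- The slack keeps the weight positive when the least mass is `0`, and provides a current although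
  -- the infimum need not be known to be attained.
  set a := √(starMass f) + ε / 2 with ha
  set b := √(starMass g) + ε / 2 with hb
  have ha0 : 0 < a := by positivity
  have hb0 : 0 < b := by positivity
  obtain ⟨T, hT, hTm⟩ := exists_mass_le hf (b := a ^ 2)
    ((Real.sqrt_lt' ha0).1 (by linarith))
  obtain ⟨S, hS, hSm⟩ := exists_mass_le hg (b := b ^ 2)
    ((Real.sqrt_lt' hb0).1 (by linarith))
  have h : starMass (f + g) ≤ (a + b) ^ 2 := by
    refine starMass_le (mem_Gam_add hf.1 hg.1 hT hS ha0 hb0) (by positivity) ?_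
    have h1 : (a + b) ^ 2 = (a + b) / a * a ^ 2 + (a + b) / b * b ^ 2 := by
      field_simp
    rw [h1, ENNReal.ofReal_add (by positivity) (by positivity),
      ENNReal.ofReal_mul (by positivity), ENNReal.ofReal_mul (by positivity)]
    refine (Current11.mass_add_le _ _).trans (add_le_add ?_ ?_)
    · exact (Current11.mass_smul_le (by positivity) T).trans (by gcongr)
    · exact (Current11.mass_smul_le (by positivity) S).trans (by gcongr)
  calc √(starMass (f + g)) ≤ a + b := Real.sqrt_le_iff.2 ⟨by positivity, h⟩
    _ = _ := by rw [ha, hb]; ring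

lemma starMass_smul_le {f : L2 Ω} (hf : f ∈ WStar Ω) (c : ℝ) :
    starMass (c • f) ≤ c ^ 2 * starMass f := by
  refine le_of_forall_pos_le_add fun ε hε => ?_
  obtain ⟨T, hT, hTm⟩ := exists_mass_le hf
    (lt_add_of_pos_right (starMass f) (show 0 < ε / (c ^ 2 + 1) by positivity))
  have h0 := starMass_nonneg f
  have h : starMass (c • f) ≤ c ^ 2 * (starMass f + ε / (c ^ 2 + 1)) := by
    refine starMass_le (mem_Gam_smul hf.1 hT c) (by positivity) ?_
    rw [ENNReal.ofReal_mul (sq_nonneg c)]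
    exact (Current11.mass_smul_le (sq_nonneg c) T).trans (by gcongr)
  have h2 : c ^ 2 * (ε / (c ^ 2 + 1)) ≤ ε := by
    rw [← mul_div_assoc, div_le_iff₀ (by positivity)]
    nlinarith
  linarith

/-- The reverse inequality is the same estimate applied to `c • f` and the scalar `c⁻¹`. -/
lemma starMass_smul {f : L2 Ω} (hf : f ∈ WStar Ω) (c : ℝ) :
    starMass (c • f) = c ^ 2 * starMass f := by
  refine le_antisymm (starMass_smul_le hf c) ?_
  by_cases hc : c = 0
  · simpa [hc] using starMass_nonneg (0 : L2 Ω)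
  · have h := starMass_smul_le ((WStarSub Ω).smul_mem c hf) c⁻¹
    rw [smul_smul, inv_mul_cancel₀ hc, one_smul, inv_pow, ← div_eq_inv_mul,
      le_div_iff₀ (by positivity)] at h
    linarith

lemma starNorm_eq (f : L2 Ω) : starNorm f = √(‖f‖ ^ 2 + starMass f) := rfl

/-- Minkowski's inequality in `ℝ²`, read off from the absolute value on `ℂ`. -/
lemma sqrt_sq_add_sq_add_le (a b c d : ℝ) :
    √((a + b) ^ 2 + (c + d) ^ 2) ≤ √(a ^ 2 + c ^ 2) + √(b ^ 2 + d ^ 2) := by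
  have h := norm_add_le ((a : ℂ) + c * Complex.I) ((b : ℂ) + d * Complex.I)
  have e : (a : ℂ) + c * Complex.I + (b + d * Complex.I)
      = ((a + b : ℝ) : ℂ) + ((c + d : ℝ) : ℂ) * Complex.I := by
    push_cast
    ring
  rwa [e, Complex.norm_add_mul_I, Complex.norm_add_mul_I, Complex.norm_add_mul_I] at h

lemma isNormOn_starNorm : IsNormOn (WStarSub Ω) starNorm where
  nonneg f _ := Real.sqrt_nonneg _
  eq_zero f _ h := by
    rw [starNorm_eq, Real.sqrt_eq_zero (by have := starMass_nonneg f; positivity)] at h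
    have := starMass_nonneg f
    have h1 : ‖f‖ ^ 2 = 0 := by nlinarith [sq_nonneg ‖f‖]
    simpa using h1
  smul c f hf := by
    rw [starNorm_eq, starNorm_eq, starMass_smul hf, norm_smul, Real.norm_eq_abs, mul_pow, sq_abs,
      ← mul_add, Real.sqrt_mul (sq_nonneg c), Real.sqrt_sq_eq_abs]
  add_le f hf g hg := by
    have h := sqrt_sq_add_sq_add_le ‖f‖ ‖g‖ √(starMass f) √(starMass g)
    rw [Real.sq_sqrt (starMass_nonneg f), Real.sq_sqrt (starMass_nonneg g)] at h
    refine le_trans (Real.sqrt_le_sqrt ?_) h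
    refine add_le_add (pow_le_pow_left₀ (norm_nonneg _) (norm_add_le f g) 2) ?_
    exact (Real.sqrt_le_left (by positivity)).1 (sqrt_starMass_add_le hf hg)

lemma sqrt_gradSq_le_starNorm {f : L2 Ω} (hf : f ∈ WStar Ω) :
    √(‖f‖ ^ 2 + omegaConst n / 4 * gradSq f) ≤ starNorm f :=
  Real.sqrt_le_sqrt (add_le_add_right (gradSq_le_starMass hf) _)

lemma sobolevNorm_le_starNorm {f : L2 Ω} (hf : f ∈ WStar Ω) :
    sobolevNorm f ≤ max 1 √(4 / omegaConst n) * starNorm f := by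
  refine le_trans ?_ (mul_le_mul_of_nonneg_left (sqrt_gradSq_le_starNorm hf) (by positivity))
  have hc := omegaConst_pos n
  set K := max 1 √(4 / omegaConst n)
  have hK1 : 1 ≤ K := le_max_left _ _
  have hK2 : 4 / omegaConst n ≤ K ^ 2 :=
    (Real.sqrt_le_left (by linarith)).1 (le_max_right _ _)
  rw [sobolevNorm, Real.sqrt_le_iff]
  refine ⟨by positivity, ?_⟩
  have hg := gradSq_nonneg f
  rw [mul_pow, Real.sq_sqrt (by positivity), mul_add]
  refine add_le_add ?_ ?_
  · exact le_mul_of_one_le_left (sq_nonneg _) (one_le_pow₀ hK1)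
  · calc gradSq f = 4 / omegaConst n * (omegaConst n / 4 * gradSq f) := by field_simp
      _ ≤ _ := by gcongr

/-! ### Summing series, and completeness for `‖·‖_*` -/

lemma gradSq_le_sobolevNorm_sq (f : L2 Ω) : gradSq f ≤ sobolevNorm f ^ 2 := by
  rw [sobolevNorm, Real.sq_sqrt (add_nonneg (sq_nonneg _) (gradSq_nonneg f))]
  linarith [sq_nonneg ‖f‖]

lemma norm_le_sobolevNorm (f : L2 Ω) : ‖f‖ ≤ sobolevNorm f :=
  Real.le_sqrt_of_sq_le (by linarith [gradSq_nonneg f])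

/-- The sum of a series whose terms are controlled by currents `T i` with `‖T i‖ ≤ a i ^ 2` and
`∑ a i < ∞` is controlled by the current `∑ (2 A / a i) T i`, with `A = ∑ a i`. -/
lemma exists_mem_Gam_of_series {v : ℕ → L2 Ω} (hv : ∀ i, v i ∈ W12 Ω) {a : ℕ → ℝ}
    (ha : ∀ i, 0 < a i) (hsum : Summable a) {T : ℕ → Current11 Ω} (hT : ∀ i, T i ∈ Gam (v i))
    (hm : ∀ i, (T i).mass ≤ ENNReal.ofReal (a i ^ 2)) {f : L2 Ω} (hf : f ∈ W12 Ω)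
    (hlim : Filter.Tendsto (fun k => sobolevNorm (f - ∑ i ∈ Finset.range k, v i))
      .atTop (nhds 0)) :
    ∃ S ∈ Gam f, S.mass ≤ ENNReal.ofReal (2 * (∑' i, a i) ^ 2) := by
  set A := ∑' i, a i with hA
  have hApos : 0 < A := hsum.tsum_pos (fun i => (ha i).le) 0 (ha 0)
  have hcoef : ∀ i, 0 ≤ 2 * A / a i := fun i => by
    have := ha i
    positivity
  have hpos : ∀ i, (((2 * A / a i : ℝ) : ℂ) • T i).IsPositive := fun i =>
    (hT i).1.smul (hcoef i)
  have hmass : ∀ i, (((2 * A / a i : ℝ) : ℂ) • T i).mass ≤ ENNReal.ofReal (2 * A * a i) := by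
    intro i
    refine (Current11.mass_smul_le (hcoef i) (T i)).trans ?_
    have h1 : 2 * A * a i = 2 * A / a i * a i ^ 2 := by
      have := (ha i).ne'
      field_simp
    rw [h1, ENNReal.ofReal_mul (hcoef i)]
    gcongr
    exact hm i
  have hb0 : ∀ i, 0 ≤ 2 * A * a i := fun i => by
    have := ha i
    positivity
  have hbsum : Summable fun i => 2 * A * a i := hsum.mul_left _
  obtain ⟨S, hS⟩ := exists_hasSum_current hpos hmass hb0 hbsum
  have hSpos : S.IsPositive := fun Φ hΦ => (hasSum_pair hS Φ).nonneg fun i => hpos i Φ hΦ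
  refine ⟨S, ⟨hSpos, isClosed_of_hasSum hS fun i => (hT i).2.1.smul _, fun Φ hΦ => ?_⟩, ?_⟩
  · rw [Current11.pair_sub, sub_nonneg, Complex.le_def]
    refine ⟨?_, by rw [← (Complex.nonneg_iff.1 (hSpos Φ hΦ)).2,
      ← (Complex.nonneg_iff.1 (isPositive_dfdcf f Φ hΦ)).2]⟩
    set q : L2 Ω → ℝ := fun g => ((dfdcf g).pair Φ).re with hq
    set r : ℕ → ℝ := fun i => ((T i).pair Φ).re with hr
    have hr0 : ∀ i, 0 ≤ r i := fun i => (Complex.nonneg_iff.1 ((hT i).1 Φ hΦ)).1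
    have hqr : ∀ i, q (v i) ≤ r i := fun i => by
      have := (hT i).2.2 Φ hΦ
      rw [Current11.pair_sub, sub_nonneg] at this
      exact (Complex.le_def.1 this).1
    have hqadd : ∀ g h : L2 Ω, g ∈ W12 Ω → h ∈ W12 Ω → ∀ s t : ℝ, 0 < s → 0 < t →
        q (g + h) ≤ (s + t) / s * q g + (s + t) / t * q h := by
      intro g h hg hh s t hs ht
      have := (Complex.le_def.1 (pair_dfdcf_add_le hg hh hs ht hΦ)).1
      rwa [Complex.add_re, Complex.re_ofReal_mul, Complex.re_ofReal_mul] at this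
    have hmem : ∀ k, ∑ i ∈ Finset.range k, v i ∈ W12 Ω := fun k =>
      (W12Sub Ω).sum_mem fun i _ => hv i
    -- Induction with weights `s`, the current prefactor, and `a k`: both resulting terms acquire
    -- the common factor `s + a k`. Adding `A` to the partial sum keeps `s` positive at `k = 0`, and
    -- costs only the factor `2` in `2 * A`.
    have hpart : ∀ k, q (∑ i ∈ Finset.range k, v i)
        ≤ (∑ i ∈ Finset.range k, a i + A) * ∑ i ∈ Finset.range k, r i / a i := by
      intro k
      induction k with
      | zero => simp [hq, dfdcf_zero, Current11.pair_zero]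
      | succ k ih =>
        have hs : 0 < ∑ i ∈ Finset.range k, a i + A :=
          add_pos_of_nonneg_of_pos (Finset.sum_nonneg fun i _ => (ha i).le) hApos
        rw [Finset.sum_range_succ, Finset.sum_range_succ a, Finset.sum_range_succ (fun i => r i / a i)]
        refine (hqadd _ _ (hmem k) (hv k) _ _ hs (ha k)).trans ?_
        set s := ∑ i ∈ Finset.range k, a i + A
        have hak := ha k
        have h1 : (s + a k) / s * q (∑ i ∈ Finset.range k, v i)
            ≤ (s + a k) / s * (s * ∑ i ∈ Finset.range k, r i / a i) := by gcongr
        have h2 : (s + a k) / a k * q (v k) ≤ (s + a k) / a k * r k := by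
          gcongr
          exact hqr k
        refine (add_le_add h1 h2).trans (le_of_eq ?_)
        rw [show ∑ i ∈ Finset.range k, a i + a k + A = s + a k by ring]
        field_simp
    have hR := Complex.hasSum_re (hasSum_pair hS Φ)
    simp only [Current11.pair_smul, Complex.re_ofReal_mul] at hR
    have hpartR : ∀ k, q (∑ i ∈ Finset.range k, v i) ≤ (S.pair Φ).re := by
      intro k
      have h0 : ∀ i, 0 ≤ r i / a i := fun i => div_nonneg (hr0 i) (ha i).le
      calc q (∑ i ∈ Finset.range k, v i)
          ≤ (∑ i ∈ Finset.range k, a i + A) * ∑ i ∈ Finset.range k, r i / a i := hpart k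
        _ ≤ (A + A) * ∑ i ∈ Finset.range k, r i / a i := by
            have := hsum.sum_le_tsum (Finset.range k) fun i _ => (ha i).le
            have h1 := Finset.sum_nonneg fun i (_ : i ∈ Finset.range k) => h0 i
            gcongr
        _ = ∑ i ∈ Finset.range k, 2 * A / a i * r i := by
            rw [Finset.mul_sum]
            refine Finset.sum_congr rfl fun i _ => ?_
            ring
        _ ≤ (S.pair Φ).re := by
            rw [← hR.tsum_eq]
            exact hR.summable.sum_le_tsum _ fun i _ => mul_nonneg (hcoef i) (hr0 i)
    obtain ⟨C, hC⟩ := exists_norm_pair_dfdcf_le Φ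
    have hgrad : Filter.Tendsto (fun k => gradSq (f - ∑ i ∈ Finset.range k, v i))
        .atTop (nhds 0) :=
      squeeze_zero (fun k => gradSq_nonneg _) (fun k => gradSq_le_sobolevNorm_sq _)
        (by simpa using hlim.pow 2)
    -- Split `f` into a partial sum and a remainder, with weights `1` and `t`. For fixed `t` the
    -- remainder vanishes as `k → ∞`, despite the factor `(1 + t) / t`; only then does `t` tend to
    -- `0`.
    have hstep : ∀ t : ℝ, 0 < t → q f ≤ (1 + t) * (S.pair Φ).re := by
      intro t ht
      have hlim' : Filter.Tendsto (fun k => (1 + t) * (S.pair Φ).re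
          + (1 + t) / t * (C * gradSq (f - ∑ i ∈ Finset.range k, v i))) .atTop
          (nhds ((1 + t) * (S.pair Φ).re)) := by
        simpa using tendsto_const_nhds.add ((hgrad.const_mul C).const_mul ((1 + t) / t))
      refine ge_of_tendsto' hlim' fun k => ?_
      have h1 := hqadd _ _ (hmem k) ((W12Sub Ω).sub_mem hf (hmem k)) 1 t one_pos ht
      rw [add_sub_cancel, div_one] at h1
      refine h1.trans (add_le_add ?_ ?_)
      · gcongr
        exact hpartR k
      · gcongr
        exact (Complex.re_le_norm _).trans (hC _)
    have hlim0 : Filter.Tendsto (fun t : ℝ => (1 + t) * (S.pair Φ).re) (nhdsWithin 0 (Set.Ioi 0))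
        (nhds (S.pair Φ).re) := by
      have : Filter.Tendsto (fun t : ℝ => (1 + t) * (S.pair Φ).re) (nhds 0)
          (nhds ((1 + 0) * (S.pair Φ).re)) := by
        exact Continuous.tendsto (by fun_prop) 0
      rw [add_zero, one_mul] at this
      exact this.mono_left nhdsWithin_le_nhds
    refine ge_of_tendsto hlim0 ?_
    filter_upwards [self_mem_nhdsWithin] with t ht using hstep t ht
  · refine (mass_le_of_hasSum hS hb0 hmass hbsum).trans (le_of_eq ?_)
    rw [tsum_mul_left]
    congr 1
    ring

lemma isBanachWith_starNorm : IsBanachWith (WStarSub Ω) starNorm := by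
  refine isNormOn_starNorm.isBanachWith fun u hu hs => ?_
  have hsob : Summable fun k => sobolevNorm (u k) :=
    .of_nonneg_of_le (fun k => sobolevNorm_nonneg _) (fun k => sobolevNorm_le_starNorm (hu k))
      (hs.mul_left _)
  obtain ⟨f, hf, hlim⟩ := exists_tendsto_sobolevNorm (fun k => (hu k).1) hsob
  -- The summable excess makes `a i` positive and `a i ^ 2` strictly larger than the least mass, so
  -- an admissible current of mass at most `a i ^ 2` exists.
  set a : ℕ → ℝ := fun i => starNorm (u i) + (1 / 2) ^ i with ha
  have ha0 : ∀ i, 0 < a i := fun i => by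
    have := isNormOn_starNorm.nonneg _ (hu i)
    positivity
  have hasum : Summable a := hs.add summable_geometric_two
  have hT : ∀ i, ∃ T ∈ Gam (u i), T.mass ≤ ENNReal.ofReal (a i ^ 2) := by
    intro i
    refine exists_mass_le (hu i) ?_
    have h1 : starMass (u i) ≤ starNorm (u i) ^ 2 := by
      have := starMass_nonneg (u i)
      rw [starNorm_eq, Real.sq_sqrt (by positivity)]
      linarith [sq_nonneg ‖u i‖]
    refine h1.trans_lt (pow_lt_pow_left₀ ?_ (isNormOn_starNorm.nonneg _ (hu i)) two_ne_zero)
    exact lt_add_of_pos_right _ (by positivity)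
  choose T hTG hTm using hT
  have hmem : ∀ k, ∑ i ∈ Finset.range k, u i ∈ W12 Ω := fun k =>
    (W12Sub Ω).sum_mem fun i _ => (hu i).1
  -- The remainder is the sum of the shifted series, so its least mass is at most twice the square
  -- of a tail of `∑ a i`. The case `k = 0` puts `f` in `W^*`; letting `k → ∞` gives convergence.
  have htail : ∀ k, ∃ S ∈ Gam (f - ∑ i ∈ Finset.range k, u i),
      S.mass ≤ ENNReal.ofReal (2 * (∑' i, a (i + k)) ^ 2) := by
    intro k
    refine exists_mem_Gam_of_series (v := fun i => u (i + k)) (fun i => (hu _).1)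
      (fun i => ha0 _) ((summable_nat_add_iff k).2 hasum) (fun i => hTG _) (fun i => hTm _)
      ((W12Sub Ω).sub_mem hf (hmem k)) ?_
    refine ((Filter.tendsto_add_atTop_iff_nat k).2 hlim).congr fun j => ?_
    rw [add_comm j k, Finset.sum_range_add, sub_sub]
    simp only [add_comm k]
  have hfS : f ∈ WStar Ω := by
    obtain ⟨S, hS, hSm⟩ := htail 0
    rw [Finset.sum_range_zero, sub_zero] at hS
    exact ⟨hf, S, hS, hSm.trans_lt ENNReal.ofReal_lt_top⟩
  refine ⟨f, hfS, ?_⟩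
  have hbound : ∀ k, starNorm (f - ∑ i ∈ Finset.range k, u i)
      ≤ √(sobolevNorm (f - ∑ i ∈ Finset.range k, u i) ^ 2 + 2 * (∑' i, a (i + k)) ^ 2) := by
    intro k
    obtain ⟨S, hS, hSm⟩ := htail k
    refine Real.sqrt_le_sqrt (add_le_add ?_ (starMass_le hS (by positivity) hSm))
    exact pow_le_pow_left₀ (norm_nonneg _) (norm_le_sobolevNorm _) 2
  refine squeeze_zero (fun k => Real.sqrt_nonneg _) hbound ?_
  have h := ((hlim.pow 2).add (((tendsto_sum_nat_add a).pow 2).const_mul 2)).sqrt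
  simpa using h

/-- Approximation in `‖·‖_*` implies approximation in `W^{1,2}` up to the factor `K`, and
`W^{1,2}_0` is closed there. -/
lemma isBanachWith_starNorm_zero : IsBanachWith (WStarSub Ω ⊓ W12ZeroSub Ω) starNorm := by
  refine isBanachWith_starNorm.of_le inf_le_left fun f hf happ => ⟨hf, ?_⟩
  refine mem_W12Zero_of_approx hf.1 fun ε hε => ?_
  set K := max 1 √(4 / omegaConst n)
  have hK : 0 < K := lt_max_of_lt_left one_pos
  obtain ⟨g, hg, hfg⟩ := happ (ε / K) (by positivity)
  refine ⟨g, hg.2, (sobolevNorm_le_starNorm ((WStarSub Ω).sub_mem hf hg.1)).trans_lt ?_⟩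
  rwa [lt_div_iff₀' hK] at hfg

end ComplexSobolev

end

theorem mainTheorem11 (n : ℕ) (hn : 1 ≤ n) (Ω : TopologicalSpace.Opens (ComplexSobolev.Cn n))
    (hbdd : Bornology.IsBounded (Ω : Set (ComplexSobolev.Cn n)))
    (hconn : IsConnected (Ω : Set (ComplexSobolev.Cn n))) :
    ∃ V V₀ : Submodule ℝ (ComplexSobolev.L2 Ω),
      (V : Set (ComplexSobolev.L2 Ω)) = ComplexSobolev.WStar Ω ∧
      (V₀ : Set (ComplexSobolev.L2 Ω)) = ComplexSobolev.WStarZero Ω ∧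
      ComplexSobolev.IsNormOn V ComplexSobolev.starNorm ∧
      (∀ f ∈ V, √(‖f‖ ^ 2 + ComplexSobolev.omegaConst n / 4 * ComplexSobolev.gradSq f)
        ≤ ComplexSobolev.starNorm f) ∧
      (∀ f ∈ V, ComplexSobolev.sobolevNorm f
        ≤ max 1 √(4 / ComplexSobolev.omegaConst n) * ComplexSobolev.starNorm f) ∧
      ComplexSobolev.IsBanachWith V ComplexSobolev.starNorm ∧
      ComplexSobolev.IsBanachWith V₀ ComplexSobolev.starNorm :=
  ⟨ComplexSobolev.WStarSub Ω, ComplexSobolev.WStarSub Ω ⊓ ComplexSobolev.W12ZeroSub Ω, rfl, rfl,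
    ComplexSobolev.isNormOn_starNorm, fun _ hf => ComplexSobolev.sqrt_gradSq_le_starNorm hf,
    fun _ hf => ComplexSobolev.sobolevNorm_le_starNorm hf, ComplexSobolev.isBanachWith_starNorm,
    ComplexSobolev.isBanachWith_starNorm_zero⟩
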